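/- **Definitions.** A family of (locally finite, rooted) networks is a triple $\mathcal N=(\mathcal V,\mathbf A,\rho)$, where $\mathcal V$ is a set, $\rho\in\mathcal V$ and $\mathbf A=(A_j)_{j\in J}$ is a countable family of complex matrices indexed by $\mathcal V\times\mathcal V$, each with finitely many nonzero elements on each row and column. Distances are those of the graph in which $v\ne w$ are adjacent if $A_j(v,w)\neq0$ or $A_j(w,v)\ne 0$ for some $j$; $\mathcal V_p$ is the set of vertices at distance less than $p$ to $\rho$. The local topology is generated by the sets $\{\mathcal N : |\mathcal V_p|=n$ and, for some bijection $\phi:\{1,\dots,n\}\to \mathcal V_p$ with $\phi(i)=\rho$, $(A_j(\phi(k),\phi(l)))_{k,l\le n,\,j\in J}\in o\}$, with $p\geq 0$, $1\le i\le n$ and $o$ open in $\mathrm M_n(\mathbb C)^J$; weak local convergence is convergence in law for this topology. A random network has a random vertex set contained in a fixed countable set, and a measurable vertex set, root and matrix entries. A $*$-test graph $T=(V,E,\gamma,\varepsilon)$ in variables $(x_j)_{j\in J}$ is a finite connected directed multigraph $(V,E)$ with maps $\gamma:E\to J$, $\varepsilon:E\to\{1,*\}$. A random network is unimodular if for every $T$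 and every $r\in V$ the expectation $$\tau[(T,r)(\mathbf A,\rho)]=\mathbb E\Big[\sum_{\phi:V\to\mathcal V,\ \phi(r)=\rho}\ \prod_{e=(v,w)\in E}A_{\gamma(e)}^{\varepsilon(e)}(\phi(v),\phi(w))\Big],\qquad A^*(v,w)=\overline{A(w,v)},$$ exists (the random variable is integrable) and does not depend on $r$. Then $\tau[T]=\tau[(T,r)(\mathbf A,\rho)]$ is its distribution of traffics. The injective version $\tau^0$ of a functional $\tau$ on test graphs is given implicitly by $\tau[T]=\sum_{\pi}\tau^0[T^\pi]$, the sum being over the partitions $\pi$ of $V$, where $T^\pi$ is obtained from $T$ by identifying the vertices in a same block of $\pi$. Let $\mathbf x_1,\dots,\mathbf x_p$ be disjoint families of variables. The colored components of a $*$-test graph $T$ in $(\mathbf x_1,\dots,\mathbf x_p)$ are the maximal connected subgraphs with at least one edge whose edges are all labelled in a same family. $T$ is a free product if the following bipartite graph is a tree (or is empty, when $T$ has no edge): its vertices are the colored components and the vertices of $T$ that belong to several of them, with an edge between a component and each such vertex it contains. A functional $\tau$ on $*$-test graphs in $(\mathbf x_1,\dots,\mathbf x_p)$ is the traffic-free product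 of $\tau_1,\dots,\tau_p$ if for every $T$ $$\tau^0[T]=\prod_{\tilde T}\tau_{q(\tilde T)}^0[\tilde T]\ \text{ if } T \text{ is a free product},\qquad \tau^0[T]=0\ \text{ otherwise},$$ where the product is over the colored components $\tilde T$ and $q(\tilde T)$ is the index of the family that labels $\tilde T$. **Local free product.** Let $\mathcal N_1,\dots,\mathcal N_p$ be unimodular random networks, with $\mathbf A_q=(A_{q,j})_{j\in J_q}$. The network $\mathcal N^{(1)}$ is obtained by sampling independent realizations of the connected components of the roots of $\mathcal N_1,\dots,\mathcal N_p$ and identifying their roots to a single vertex $\rho$, the other vertices being pairwise distinct; it is rooted at $\rho$. Given $\mathcal N^{(n)}$, for each vertex $v$ created at the $n$-th step, which comes from a realization of one network $\mathcal N_{q_0}$, sample new independent realizations of (the root component of) $\mathcal N_q$ for all $q\neq q_0$ and identify their roots with $v$, the other vertices being pairwise distinct. All samples are independent. Still rooted at $\rho$, this gives $\mathcal N^{(n+1)}$. Let $\mathcal N^{(\infty)}=(\mathcal V^{(\infty)},\mathbf A^{(\infty)},\rho)$ be the union of the $\mathcal N^{(n)}$, with $\mathbf A^{(\infty)}=(\tilde{\mathbf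 A}_1,\dots,\tilde{\mathbf A}_p)$, where $\tilde{\mathbf A}_q$ collects the matrices of all the copies of $\mathcal N_q$. **Proposition.** The sequence $\mathcal N^{(n)}$ converges to $\mathcal N^{(\infty)}$ in the weak local topology, $\mathcal N^{(\infty)}$ is a unimodular random network, and the joint distribution of traffics of $\tilde{\mathbf A}_1,\dots,\tilde{\mathbf A}_p$ in $\mathcal N^{(\infty)}$ is the traffic-free product of the distributions of traffics of $\mathbf A_1,\dots,\mathbf A_p$. -/

import Mathlib

open MeasureTheory Filter Topology ProbabilityTheory
open scoped ComplexConjugate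

universe u v w

/-! ## Test graphs -/

/-- A `*`-test graph in the variables `(x_j)_{j ∈ J}`: a finite connected directed multigraph whose
edges `e` carry a label `x_{lab e}` (if `star e = false`) or `x_{lab e}^*` (if `star e = true`). -/
structure TestGraph (J : Type u) where
  V : Type
  E : Type
  fintypeV : Fintype V
  fintypeE : Fintype E
  src : E → V
  tgt : E → V
  lab : E → J
  star : E → Bool
  connected : (SimpleGraph.fromRel (fun a b : V => ∃ e, src e = a ∧ tgt e = b)).Connected

namespace TestGraph

attribute [instance] TestGraph.fintypeV TestGraph.fintypeE

/-- A map that sends every edge of `T` to an adjacent or equal pair preserves reachability. -/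
theorem reachable_of_edges {J : Type u} (T : TestGraph J) {W : Type*} (G : SimpleGraph W)
    (f : T.V → W) (h : ∀ e, G.Reachable (f (T.src e)) (f (T.tgt e))) (a b : T.V) :
    G.Reachable (f a) (f b) := by
  obtain ⟨p⟩ := T.connected.preconnected a b
  induction p with
  | nil => exact SimpleGraph.Reachable.refl _
  | cons hadj _ ih =>
    refine SimpleGraph.Reachable.trans ?_ ih
    rw [SimpleGraph.fromRel_adj] at hadj
    obtain ⟨-, ⟨e, rfl, rfl⟩ | ⟨e, rfl, rfl⟩⟩ := hadj
    · exact h e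
    · exact (h e).symm

/-- The two ends of an edge are reachable from one another in the underlying graph. -/
theorem reachable_src_tgt {W F : Type*} (s t : F → W) (e : F) :
    (SimpleGraph.fromRel (fun a b : W => ∃ e, s e = a ∧ t e = b)).Reachable (s e) (t e) := by
  by_cases h : s e = t e
  · rw [h]
  · exact SimpleGraph.Adj.reachable
      ((SimpleGraph.fromRel_adj _ _ _).2 ⟨h, Or.inl ⟨e, rfl, rfl⟩⟩)

/-- The quotient `T^π`: the vertices in a same block of the partition `π` are identified. -/
noncomputable def quot {J : Type u} (T : TestGraph J) (π : Setoid T.V) : TestGraph J where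
  V := Quotient π
  E := T.E
  fintypeV := Fintype.ofFinite _
  fintypeE := T.fintypeE
  src e := Quotient.mk π (T.src e)
  tgt e := Quotient.mk π (T.tgt e)
  lab := T.lab
  star := T.star
  connected := by
    obtain ⟨x⟩ := T.connected.nonempty
    have : Nonempty (Quotient π) := ⟨Quotient.mk π x⟩
    refine SimpleGraph.Connected.mk ?_
    intro a b
    induction a using Quotient.inductionOn with | _ a => ?_
    induction b using Quotient.inductionOn with | _ b => ?_
    exact T.reachable_of_edges _ (Quotient.mk π)
      (reachable_src_tgt (fun e => Quotient.mk π (T.src e)) (fun e => Quotient.mk π (T.tgt e))) a b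

/-- There are finitely many partitions of the vertex set. -/
instance finitePartition {J : Type u} (T : TestGraph J) : Finite (Setoid T.V) :=
  Finite.of_injective (fun π : Setoid T.V => fun a b => π a b)
    (fun _ _ h => Setoid.ext fun a b => iff_of_eq (congrFun (congrFun h a) b))

noncomputable instance fintypeNontrivialPartition {J : Type u} (T : TestGraph J) :
    Fintype {π : Setoid T.V // π ≠ ⊥} :=
  Fintype.ofFinite _

theorem card_quot_lt {J : Type u} (T : TestGraph J) (π : Setoid T.V) (h : π ≠ ⊥) :
    Fintype.card (T.quot π).V < Fintype.card T.V := by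
  refine Fintype.card_lt_of_surjective_not_injective (Quotient.mk π : T.V → (T.quot π).V)
    Quotient.mk_surjective ?_
  intro hinj
  refine h (Setoid.ext fun a b => ⟨fun hab => hinj (Quotient.sound hab), ?_⟩)
  rintro rfl
  exact π.refl _

/-- The injective version `τ⁰` of a functional `τ` on test graphs, defined implicitly by
`τ[T] = ∑_π τ⁰[T^π]`, the sum over all partitions `π` of the vertex set of `T`. The term of the
trivial partition `⊥` is `τ⁰[T]`, and the other quotients have fewer vertices. -/
noncomputable def injectiveVersion {J : Type u} (τ : TestGraph J → ℂ) (T : TestGraph J) : ℂ :=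
  τ T - ∑ π : {π : Setoid T.V // π ≠ ⊥}, injectiveVersion τ (T.quot π.1)
termination_by Fintype.card T.V
decreasing_by exact card_quot_lt T π.1 π.2

/-! ### Colored components and free products of test graphs

The families of variables `x_q = (x_{q,j})_{j ∈ J q}` are indexed by `q : ι`. -/

section Colored

/-- Two edges are related if their labels are in a same family and they share a vertex. -/
def EdgeRel {ι : Type w} {J : ι → Type u} (T : TestGraph (Σ q, J q)) (e e' : T.E) : Prop :=
  (T.lab e).1 = (T.lab e').1 ∧
    (T.src e = T.src e' ∨ T.src e = T.tgt e' ∨ T.tgt e = T.src e' ∨ T.tgt e = T.tgt e')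

/-- The colored components `T_1, …, T_K` of `T` (the connected components of `T` that are labelled
with variables in a same family), as classes of edges. -/
def Comp {ι : Type w} {J : ι → Type u} (T : TestGraph (Σ q, J q)) : Type :=
  Quotient (Relation.EqvGen.setoid T.EdgeRel)

/-- The colored component of an edge. -/
def comp {ι : Type w} {J : ι → Type u} (T : TestGraph (Σ q, J q)) (e : T.E) : T.Comp :=
  Quotient.mk (Relation.EqvGen.setoid T.EdgeRel) e

noncomputable instance fintypeComp {ι : Type w} {J : ι → Type u} (T : TestGraph (Σ q, J q)) :
    Fintype T.Comp :=
  have : Finite T.Comp := Finite.of_surjective T.comp Quotient.mk_surjective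
  Fintype.ofFinite _

/-- The index `i_{T̃}` of the family of variables that label a colored component. -/
def color {ι : Type w} {J : ι → Type u} (T : TestGraph (Σ q, J q)) : T.Comp → ι :=
  Quotient.lift (fun e => (T.lab e).1) (by
    intro a b h
    induction h with
    | rel _ _ h => exact h.1
    | refl _ => rfl
    | symm _ _ _ ih => exact ih.symm
    | trans _ _ _ _ _ ih1 ih2 => exact ih1.trans ih2)

theorem color_comp {ι : Type w} {J : ι → Type u} (T : TestGraph (Σ q, J q)) (e : T.E) :
    T.color (T.comp e) = (T.lab e).1 := rfl

/-- `a` is a vertex of the colored component `c`. -/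
def InComp {ι : Type w} {J : ι → Type u} (T : TestGraph (Σ q, J q)) (c : T.Comp) (a : T.V) : Prop :=
  ∃ e, T.comp e = c ∧ (T.src e = a ∨ T.tgt e = a)

/-- A colored component, as a test graph in the variables of its family. -/
noncomputable def compGraph {ι : Type w} {J : ι → Type u} (T : TestGraph (Σ q, J q)) (c : T.Comp) :
    TestGraph (J (T.color c)) where
  V := {a : T.V // T.InComp c a}
  E := {e : T.E // T.comp e = c}
  fintypeV := Fintype.ofFinite _
  fintypeE := Fintype.ofFinite _
  src e := ⟨T.src e.1, e.1, e.2, Or.inl rfl⟩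
  tgt e := ⟨T.tgt e.1, e.1, e.2, Or.inr rfl⟩
  lab e := cast (congrArg J ((T.color_comp e.1).symm.trans (congrArg T.color e.2))) (T.lab e.1).2
  star e := T.star e.1
  connected := by
    set s : {e : T.E // T.comp e = c} → {a : T.V // T.InComp c a} :=
      fun e => ⟨T.src e.1, e.1, e.2, Or.inl rfl⟩ with hs
    set t : {e : T.E // T.comp e = c} → {a : T.V // T.InComp c a} :=
      fun e => ⟨T.tgt e.1, e.1, e.2, Or.inr rfl⟩ with ht
    have hst := reachable_src_tgt s t
    set G := SimpleGraph.fromRel (fun a b => ∃ e, s e = a ∧ t e = b) with hG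
    have key : ∀ e e' : T.E, Relation.EqvGen T.EdgeRel e e' →
        ∀ (h : T.comp e = c) (h' : T.comp e' = c), G.Reachable (s ⟨e, h⟩) (s ⟨e', h'⟩) := by
      intro e e' hee
      induction hee with
      | rel x y hxy =>
        intro hx hy
        have h1 := hst ⟨x, hx⟩
        have h2 := hst ⟨y, hy⟩
        rcases hxy.2 with h | h | h | h
        · have : s ⟨x, hx⟩ = s ⟨y, hy⟩ := Subtype.ext h
          rw [this]
        · have : s ⟨x, hx⟩ = t ⟨y, hy⟩ := Subtype.ext h
          rw [this]; exact h2.symm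
        · have : t ⟨x, hx⟩ = s ⟨y, hy⟩ := Subtype.ext h
          rw [← this]; exact h1
        · have : t ⟨x, hx⟩ = t ⟨y, hy⟩ := Subtype.ext h
          exact h1.trans (this ▸ h2.symm)
      | refl x => intro _ _; exact SimpleGraph.Reachable.refl _
      | symm x y _ ih => intro hx hy; exact (ih hy hx).symm
      | trans x y z hxy _ ih1 ih2 =>
        intro hx hz
        have hxy' : T.comp x = T.comp y := Quotient.sound hxy
        have hy : T.comp y = c := hxy'.symm.trans hx
        exact (ih1 hx hy).trans (ih2 hy hz)
    obtain ⟨e0, he0⟩ := Quotient.mk_surjective c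
    have : Nonempty {a : T.V // T.InComp c a} := ⟨s ⟨e0, he0⟩⟩
    have base : ∀ a : {a : T.V // T.InComp c a}, G.Reachable (s ⟨e0, he0⟩) a := by
      rintro ⟨a, e, he, ha⟩
      have h0 : G.Reachable (s ⟨e0, he0⟩) (s ⟨e, he⟩) :=
        key e0 e (Quotient.exact (he0.trans he.symm)) he0 he
      rcases ha with rfl | rfl
      · exact h0
      · exact h0.trans (hst ⟨e, he⟩)
    refine SimpleGraph.Connected.mk fun a b => (base a).symm.trans (base b)

/-- The vertices of `T` that are common to several colored components. -/
def IsShared {ι : Type w} {J : ι → Type u} (T : TestGraph (Σ q, J q)) (a : T.V) : Prop :=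
  ∃ c c' : T.Comp, c ≠ c' ∧ T.InComp c a ∧ T.InComp c' a

/-- The undirected graph `T̄`: its vertices are the colored components of `T` and the vertices of `T`
that are common to several of them, with an edge between `T_i` and `v_j` if `v_j` is in `T_i`. -/
def barGraph {ι : Type w} {J : ι → Type u} (T : TestGraph (Σ q, J q)) :
    SimpleGraph (T.Comp ⊕ {a : T.V // T.IsShared a}) :=
  SimpleGraph.fromRel fun x y => ∃ c a, x = Sum.inl c ∧ y = Sum.inr a ∧ T.InComp c a.1

/-- `T` is a free product: `T̄` is a tree (or `T` is a single vertex without edges, in which case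
`T̄` is the empty graph). -/
def IsFreeProduct {ι : Type w} {J : ι → Type u} (T : TestGraph (Σ q, J q)) : Prop :=
  T.barGraph.Preconnected ∧ T.barGraph.IsAcyclic

open Classical in
/-- `τ'` is the traffic-free product of the distributions of traffics `τ q`: `τ'⁰[T]` is the product of
`τ⁰[T̃]` over the colored components `T̃` of `T` if `T` is a free product, and zero otherwise. -/
def IsTrafficFreeProduct {ι : Type w} {J : ι → Type u} (τ' : TestGraph (Σ q, J q) → ℂ)
    (τ : ∀ q, TestGraph (J q) → ℂ) : Prop :=
  ∀ T : TestGraph (Σ q, J q), injectiveVersion τ' T =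
    if T.IsFreeProduct then ∏ c : T.Comp, injectiveVersion (τ (T.color c)) (T.compGraph c) else 0

end Colored

end TestGraph

/-! ## Networks -/

/-- A family of locally finite rooted networks: the vertex set `verts` is a subset of an ambient type
`V`, and each matrix `A j` is indexed by the vertices and has finitely many nonzero elements on each
row and column. -/
structure Network (J : Type u) (V : Type v) where
  verts : Set V
  root : V
  root_mem : root ∈ verts
  A : J → V → V → ℂ
  supported : ∀ j a b, A j a b ≠ 0 → a ∈ verts ∧ b ∈ verts
  locallyFinite : ∀ j a, {b | A j a b ≠ 0 ∨ A j b a ≠ 0}.Finite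

namespace Network

/-- The underlying undirected graph: `a` and `b` are adjacent if some matrix has a nonzero entry at
`(a, b)` or at `(b, a)`. -/
def graph {J : Type u} {V : Type v} (N : Network J V) : SimpleGraph V :=
  SimpleGraph.fromRel fun a b => ∃ j, N.A j a b ≠ 0

open Classical in
/-- The connected component of the root. -/
noncomputable def rootComponent {J : Type u} {V : Type v} (N : Network J V) : Network J V where
  verts := {a | a ∈ N.verts ∧ N.graph.Reachable N.root a}
  root := N.root
  root_mem := ⟨N.root_mem, SimpleGraph.Reachable.refl _⟩
  A j a b := if N.graph.Reachable N.root a ∧ N.graph.Reachable N.root b then N.A j a b else 0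
  supported j a b h := by
    rw [ite_ne_right_iff] at h
    exact ⟨⟨(N.supported j a b h.2).1, h.1.1⟩, ⟨(N.supported j a b h.2).2, h.1.2⟩⟩
  locallyFinite j a := by
    refine (N.locallyFinite j a).subset ?_
    rintro b (h | h)
    · exact Or.inl (ite_ne_right_iff.1 h).2
    · exact Or.inr (ite_ne_right_iff.1 h).2

/-! ### The local topology -/

/-- The vertices at distance less than `p` to the root. -/
def ball {J : Type u} {V : Type v} (N : Network J V) (p : ℕ) : Set V :=
  {a | N.graph.edist N.root a < p}

/-- The basic open sets of the local topology: `N.ball p` has `n` elements, and for a suitable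
enumeration of them that gives the root the number `i`, the matrices of `N` restricted to the ball lie
in the open set `o` of families of `n × n` matrices. -/
def basicOpen (J : Type u) (V : Type v) (p n : ℕ) (i : Fin n) (o : Set (J → Fin n → Fin n → ℂ)) :
    Set (Network J V) :=
  {N | ∃ φ : Fin n ≃ N.ball p, (φ i : V) = N.root ∧ (fun j k l => N.A j (φ k) (φ l)) ∈ o}

/-- The local topology. -/
instance localTopology (J : Type u) (V : Type v) : TopologicalSpace (Network J V) :=
  TopologicalSpace.generateFrom
    {U | ∃ (p n : ℕ) (i : Fin n) (o : Set (J → Fin n → Fin n → ℂ)),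
      IsOpen o ∧ U = basicOpen J V p n i o}

instance (J : Type u) (V : Type v) : MeasurableSpace (Network J V) := borel _

instance (J : Type u) (V : Type v) : BorelSpace (Network J V) := ⟨rfl⟩

/-! ### Random networks and their distributions of traffics -/

/-- The entry at `(a, b)` of `A_j` (for `s = false`) or of `A_j^*` (for `s = true`). -/
noncomputable def entry {J : Type u} {V : Type v} (N : Network J V) (j : J) (s : Bool) (a b : V) : ℂ :=
  if s then conj (N.A j b a) else N.A j a b

/-- The sum of `∏_{e = (a, b)} A_{γ(e)}^{ε(e)}(φ(a), φ(b))` over the maps `φ` from the vertices of `T`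
to those of `N` with `φ(r)` equal to the root. As `T` is connected and `N` is locally finite, only
finitely many terms are nonzero. -/
noncomputable def rootedSum {J : Type u} {V : Type v} (N : Network J V) (T : TestGraph J) (r : T.V) :
    ℂ :=
  ∑ᶠ (φ : T.V → V) (_ : (∀ a, φ a ∈ N.verts) ∧ φ r = N.root),
    ∏ e, N.entry (T.lab e) (T.star e) (φ (T.src e)) (φ (T.tgt e))

/-- Random networks on a random subset of a countable type `V`: the vertex set, the root and the
entries of the matrices are random variables. -/
structure IsRandom {J : Type u} {V : Type v} {Ω : Type w} [MeasurableSpace Ω]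
    (N : Ω → Network J V) : Prop where
  measurableSet_verts : ∀ a, MeasurableSet {ω | a ∈ (N ω).verts}
  measurableSet_root : ∀ a, MeasurableSet {ω | (N ω).root = a}
  measurable_entry : ∀ j a b, Measurable fun ω => (N ω).A j a b

/-- The quantity `τ[(T, r)(A, ρ)]`. -/
noncomputable def rootedState {J : Type u} {V : Type v} {Ω : Type w} [MeasurableSpace Ω]
    (P : Measure Ω) (N : Ω → Network J V) (T : TestGraph J) (r : T.V) : ℂ :=
  ∫ ω, (N ω).rootedSum T r ∂P

/-- A unimodular random network: the expectation `τ[(T, r)(A, ρ)]` exists for every test graph `T`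
and every vertex `r` of `T`, and it does not depend on `r`. -/
structure IsUnimodular {J : Type u} {V : Type v} {Ω : Type w} [MeasurableSpace Ω]
    (P : Measure Ω) (N : Ω → Network J V) : Prop where
  isRandom : IsRandom N
  integrable : ∀ (T : TestGraph J) (r : T.V), Integrable (fun ω => (N ω).rootedSum T r) P
  rootedState_eq : ∀ (T : TestGraph J) (r r' : T.V), rootedState P N T r = rootedState P N T r'

/-- The distribution of traffics `T ↦ τ[T(A, ρ)] = τ[(T, r)(A, ρ)]` of a unimodular random network, for
an arbitrary choice of the vertex `r` of `T`. -/
noncomputable def distribution {J : Type u} {V : Type v} {Ω : Type w} [MeasurableSpace Ω]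
    (P : Measure Ω) (N : Ω → Network J V) (T : TestGraph J) : ℂ :=
  rootedState P N T (Classical.choice T.connected.nonempty)

/-! ### The local free product

The networks to be glued have colors `q : ι`. A vertex of the glued network is a word, a list of pairs
`⟨q, a⟩` of a color and of a vertex of the network of that color. The empty word is the root. The word
`⟨q, a⟩ :: x` is the vertex `a`, different from the root, of the copy of the network of color `q` whose
root is identified with the vertex `x`. That copy is `X (x, q)`. -/

section Glue

/-- The vertices created at the `n`-th step. At the step `n + 1`, for every vertex `x` created at the
step `n` one attaches to `x` copies of the networks of all the colors but the one of the copy from which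
`x` comes (of all the colors when `x` is the root). -/
def generation {ι : Type w} {J : ι → Type u} {V : ι → Type v}
    (X : ∀ i : List (Σ q, V q) × ι, Network (J i.2) (V i.2)) : ℕ → Set (List (Σ q, V q))
  | 0 => {[]}
  | n + 1 => {y | ∃ x ∈ generation X n, ∃ (q : ι) (a : V q), (∀ l ∈ x.head?, l.1 ≠ q) ∧
      a ∈ (X (x, q)).verts ∧ a ≠ (X (x, q)).root ∧ y = ⟨q, a⟩ :: x}

open Classical in
/-- The vertex `y` is in exactly one copy of color `q`: the one attached to the vertex `base q y`. -/
noncomputable def base {ι : Type w} {V : ι → Type v} (q : ι) :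
    List (Σ q, V q) → List (Σ q, V q)
  | [] => []
  | l :: x => if l.1 = q then x else l :: x

open Classical in
/-- The position of the vertex `y` in the copy of color `q` to which it belongs. -/
noncomputable def position {ι : Type w} {J : ι → Type u} {V : ι → Type v}
    (X : ∀ i : List (Σ q, V q) × ι, Network (J i.2) (V i.2)) (q : ι) : List (Σ q, V q) → V q
  | [] => (X ([], q)).root
  | l :: x => if h : l.1 = q then cast (congrArg V h) l.2 else (X (l :: x, q)).root

theorem eq_or_eq_of_base {ι : Type w} {J : ι → Type u} {V : ι → Type v}
    (X : ∀ i : List (Σ q, V q) × ι, Network (J i.2) (V i.2)) (q : ι) (y : List (Σ q, V q)) :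
    y = base q y ∨ y = ⟨q, position X q y⟩ :: base q y := by
  cases y with
  | nil => exact Or.inl rfl
  | cons l x =>
    obtain ⟨q', a⟩ := l
    by_cases h : q' = q
    · subst h
      exact Or.inr (by simp [base, position])
    · exact Or.inl (by simp [base, h])

open Classical in
/-- The network obtained after `n` steps, or after infinitely many steps for `n = ⊤`. Two vertices are
joined by an edge of color `(q, j)` if they are in a same copy of color `q`, attached during the first
`n` steps, and are joined there by an edge of color `j`. -/
noncomputable def glue {ι : Type w} {J : ι → Type u} {V : ι → Type v}
    (X : ∀ i : List (Σ q, V q) × ι, Network (J i.2) (V i.2)) (n : ℕ∞) :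
    Network (Σ q, J q) (List (Σ q, V q)) where
  verts := {x | ∃ m : ℕ, (m : ℕ∞) ≤ n ∧ x ∈ generation X m}
  root := []
  root_mem := ⟨0, bot_le, rfl⟩
  A c x y :=
    if ((∃ m : ℕ, (m : ℕ∞) ≤ n ∧ x ∈ generation X m) ∧ ∃ m : ℕ, (m : ℕ∞) ≤ n ∧ y ∈ generation X m) ∧
        base c.1 x = base c.1 y ∧ ((base c.1 x).length : ℕ∞) < n then
      (X (base c.1 x, c.1)).A c.2 (position X c.1 x) (position X c.1 y)
    else 0
  supported c x y h := (ite_ne_right_iff.1 h).1.1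
  locallyFinite c x := by
    refine (((((X (base c.1 x, c.1)).locallyFinite c.2 (position X c.1 x)).image
      (fun a => (⟨c.1, a⟩ :: base c.1 x : List (Σ q, V q)))).insert (base c.1 x))).subset ?_
    rintro y (h | h)
    · obtain ⟨⟨-, hb, -⟩, h⟩ := ite_ne_right_iff.1 h
      rcases eq_or_eq_of_base X c.1 y with hy | hy
      · exact Or.inl (hy.trans hb.symm)
      · exact Or.inr ⟨position X c.1 y, Or.inl h, by simp only [hb]; exact hy.symm⟩
    · obtain ⟨⟨-, hb, -⟩, h⟩ := ite_ne_right_iff.1 h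
      rw [hb] at h
      rcases eq_or_eq_of_base X c.1 y with hy | hy
      · exact Or.inl (hy.trans hb)
      · exact Or.inr ⟨position X c.1 y, Or.inr h, by simp only [← hb]; exact hy.symm⟩

end Glue

/-- The networks `𝒩^(n)` (and `𝒩^(∞)` for `n = ⊤`) of the local free product of the random networks
`N q`. The copies are the root components of `N q` at the coordinates `ω (x, q)` of a sample `ω`, to be
drawn from the product measure `sampleMeasure`, so that they are independent. -/
noncomputable def localFreeProduct {ι : Type w} {J : ι → Type u} {V : ι → Type v} {Ω : ι → Type*}
    (N : ∀ q, Ω q → Network (J q) (V q)) (n : ℕ∞) (ω : ∀ i : List (Σ q, V q) × ι, Ω i.2) :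
    Network (Σ q, J q) (List (Σ q, V q)) :=
  glue (fun i => (N i.2 (ω i)).rootComponent) n

/-- The law of independent samples `ω (x, q)` with law `P q`, one for each word `x` and color `q`. -/
noncomputable def sampleMeasure {ι : Type w} (V : ι → Type v) {Ω : ι → Type*}
    [∀ q, MeasurableSpace (Ω q)] (P : ∀ q, Measure (Ω q)) :
    Measure (∀ i : List (Σ q, V q) × ι, Ω i.2) :=
  Measure.infinitePi fun i => P i.2

instance {ι : Type w} (V : ι → Type v) {Ω : ι → Type*}
    [∀ q, MeasurableSpace (Ω q)] (P : ∀ q, Measure (Ω q)) [∀ q, IsProbabilityMeasure (P q)] :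
    IsProbabilityMeasure (sampleMeasure V P) := by
  unfold sampleMeasure
  infer_instance

end Network

/-! The glued network is tree-like: two different copies meet in at most one vertex, and the copies
and their vertices form a tree. Hence an injective map of a test graph `T` with nonzero weight sends
every colored component into a single copy, and such a map exists only if `T` is a free product
(`isFreeProduct_of_weight_ne_zero`). Conversely, root the tree of components of a free product at
`r`. A contributing injective map is then the same thing as one contributing injective map per
component, sending the vertex of the component closest to `r` to the root of its copy
(`injSum_glue`).

Distinct components lie in distinct copies, whose labels depend only on the chosen positions, not on
the sample. Independence therefore factorizes the expectation of each term, and summing gives a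
product of injective expectations over the components (`integral_injSum_glue`). By unimodularity of
the factors these are the values of the injective versions, so the product no longer depends on `r`.
Summing over the partitions of the vertices yields unimodularity and traffic freeness together.

The obstacle is integrability: the rooted sums are integrable, but the sums of the absolute values
of their terms need not be, so the exchange of sum and expectation is not directly legitimate. The
matrices of each copy are therefore set to zero outside an event on which finitely many absolute
sums are at most `K`, and then `K` tends to infinity. The product formula passes to the limit by
dominated convergence, applied in each factor to sums that are integrable. For each sample the glued
rooted sum is eventually constant in `K`, since it involves finitely many copies. Its squared
modulus is the rooted sum of the doubled graph (`rootedSum_double`), whose truncated expectations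
converge, hence are bounded; this second moment bound gives uniform integrability
(`integral_rootedSum_glue`).

Local convergence is deterministic: the ball of radius `p` no longer changes after `p` steps
(`tendsto_glue`). Convergence in law follows once the networks are shown to be Borel measurable. -/

namespace SimpleGraph

/-! ### Criteria for acyclicity and distances in trees. -/

theorem isAcyclic_of_unique_le {V : Type*} {G : SimpleGraph V} (f : V → ℕ)
    (h : ∀ x y z, G.Adj x y → G.Adj x z → f y ≤ f x → f z ≤ f x → y = z) : G.IsAcyclic := by
  classical
  intro v p hp
  -- At a point of the cycle where `f` is maximal, the two neighbours on the cycle are distinct and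
  -- neither is higher.
  obtain ⟨x, hx, hmax⟩ := p.support.toFinset.exists_max_image f
    ⟨v, List.mem_toFinset.2 p.start_mem_support⟩
  rw [List.mem_toFinset] at hx
  have hq := hp.rotate hx
  have hmem : ∀ y ∈ (p.rotate x hx).support, f y ≤ f x := fun y hy =>
    hmax y (List.mem_toFinset.2 ((p.mem_support_rotate_iff x hx).1 hy))
  refine hq.snd_ne_penultimate (h x _ _ ?_ ?_ ?_ ?_)
  · exact (p.rotate x hx).adj_snd hq.not_nil
  · exact ((p.rotate x hx).adj_penultimate hq.not_nil).symm
  · exact hmem _ ((p.rotate x hx).getVert_mem_support _)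
  · exact hmem _ ((p.rotate x hx).getVert_mem_support _)

theorem IsTree.eq_of_dist_lt {V : Type*} {G : SimpleGraph V} (hG : G.IsTree) (u : V) {x y z : V}
    (hy : G.Adj x y) (hz : G.Adj x z) (hyd : G.dist u y < G.dist u x)
    (hzd : G.dist u z < G.dist u x) : y = z := by
  classical
  obtain ⟨p, hp, -⟩ := (hG.connected u x).exists_path_of_dist
  have key : ∀ y, G.Adj x y → G.dist u y < G.dist u x → y = p.penultimate := by
    intro y hy hyd
    obtain ⟨q, hq, hq'⟩ := (hG.connected u y).exists_path_of_dist
    -- A geodesic from `u` to `y` cannot pass through `x`, which is farther; so `y` is the last but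
    -- one vertex of the path to `x`.
    refine hG.isAcyclic.eq_penultimate_of_adj_end hp hy
      (hG.isAcyclic.mem_support_of_ne_mem_support_of_adj_of_isPath hp hq hy fun hx => ?_)
    have h1 := dist_le (q.takeUntil x hx)
    have h2 := q.length_takeUntil_le_length hx
    omega
  rw [key y hy hyd, key z hz hzd]

/-- Every vertex of a cycle has two distinct neighbours, so a cycle stays inside `s` and is carried
injectively to a cycle of `H`. -/
theorem IsAcyclic.of_forall_isCycle_exists_hom {V W : Type*} {G : SimpleGraph V}
    {H : SimpleGraph W} (hH : H.IsAcyclic) (s : Set V) (f : G.induce s →g H)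
    (hf : Function.Injective f)
    (hs : ∀ x y z, G.Adj x y → G.Adj x z → y ≠ z → x ∈ s) : G.IsAcyclic := by
  classical
  intro v p hp
  have hsupp : ∀ x ∈ p.support, x ∈ s := by
    intro x hx
    have hq := hp.rotate hx
    exact hs x _ _ ((p.rotate x hx).adj_snd hq.not_nil)
      ((p.rotate x hx).adj_penultimate hq.not_nil).symm hq.snd_ne_penultimate
  have hp' : ((p.induce s hsupp).map (Embedding.induce s).toHom).IsCycle := by
    rw [Walk.map_induce]; exact hp
  exact hH.comap f hf _ hp'.of_map

theorem Connected.exists_adj_dist_lt {V : Type*} {G : SimpleGraph V} (hG : G.Connected) (u x : V)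
    (h : x ≠ u) : ∃ y, G.Adj x y ∧ G.dist u y < G.dist u x := by
  obtain ⟨p, hp, hl⟩ := (hG x u).exists_path_of_dist
  cases p with
  | nil => exact absurd rfl h
  | @cons _ y _ hadj q =>
    refine ⟨y, hadj, ?_⟩
    have := dist_le q
    rw [dist_comm, dist_comm (v := x), ← hl, Walk.length_cons]
    omega

end SimpleGraph

/-! ### The tree of colored components, rooted at a vertex. -/

namespace TestGraph

variable {ι : Type w} {J : ι → Type u} (T : TestGraph (Σ q, J q))

/-- The bipartite graph between the colored components and all the vertices. -/
def incidenceGraph : SimpleGraph (T.Comp ⊕ T.V) :=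
  SimpleGraph.fromRel fun x y => ∃ c a, x = Sum.inl c ∧ y = Sum.inr a ∧ T.InComp c a

theorem incidenceGraph_adj_inl_inr {c : T.Comp} {a : T.V} :
    T.incidenceGraph.Adj (Sum.inl c) (Sum.inr a) ↔ T.InComp c a := by
  simp [incidenceGraph, SimpleGraph.fromRel_adj]

theorem incidenceGraph_adj_inr_inl {c : T.Comp} {a : T.V} :
    T.incidenceGraph.Adj (Sum.inr a) (Sum.inl c) ↔ T.InComp c a := by
  rw [SimpleGraph.adj_comm, incidenceGraph_adj_inl_inr]

theorem not_incidenceGraph_adj_inl_inl {c c' : T.Comp} :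
    ¬ T.incidenceGraph.Adj (Sum.inl c) (Sum.inl c') := by
  simp [incidenceGraph, SimpleGraph.fromRel_adj]

theorem not_incidenceGraph_adj_inr_inr {a a' : T.V} :
    ¬ T.incidenceGraph.Adj (Sum.inr a) (Sum.inr a') := by
  simp [incidenceGraph, SimpleGraph.fromRel_adj]

theorem barGraph_adj_inl_inr {c : T.Comp} {a : {a : T.V // T.IsShared a}} :
    T.barGraph.Adj (Sum.inl c) (Sum.inr a) ↔ T.InComp c a.1 := by
  simp [barGraph, SimpleGraph.fromRel_adj]

theorem barGraph_adj_inr_inl {c : T.Comp} {a : {a : T.V // T.IsShared a}} :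
    T.barGraph.Adj (Sum.inr a) (Sum.inl c) ↔ T.InComp c a.1 := by
  rw [SimpleGraph.adj_comm, barGraph_adj_inl_inr]

theorem not_barGraph_adj_inl_inl {c c' : T.Comp} :
    ¬ T.barGraph.Adj (Sum.inl c) (Sum.inl c') := by
  simp [barGraph, SimpleGraph.fromRel_adj]

theorem not_barGraph_adj_inr_inr {a a' : {a : T.V // T.IsShared a}} :
    ¬ T.barGraph.Adj (Sum.inr a) (Sum.inr a') := by
  simp [barGraph, SimpleGraph.fromRel_adj]

theorem inComp_src (e : T.E) : T.InComp (T.comp e) (T.src e) := ⟨e, rfl, Or.inl rfl⟩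

theorem inComp_tgt (e : T.E) : T.InComp (T.comp e) (T.tgt e) := ⟨e, rfl, Or.inr rfl⟩

theorem exists_comp_eq (c : T.Comp) : ∃ e, T.comp e = c := Quotient.mk_surjective c

variable {T}

/-- Two colored components of the same color that share a vertex are equal. -/
theorem InComp.eq_of_color_eq {c c' : T.Comp} {a : T.V} (h : T.InComp c a) (h' : T.InComp c' a)
    (hc : T.color c = T.color c') : c = c' := by
  obtain ⟨e, rfl, he⟩ := h
  obtain ⟨e', rfl, he'⟩ := h'
  refine Quotient.sound (Relation.EqvGen.rel _ _ ⟨hc, ?_⟩)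
  rcases he with h | h <;> rcases he' with h' | h' <;> simp [h, h']

variable (T)

theorem exists_edge_of_ne {a b : T.V} (h : a ≠ b) : ∃ e, T.src e = a ∨ T.tgt e = a := by
  obtain ⟨p⟩ := T.connected.preconnected a b
  cases p with
  | nil => exact absurd rfl h
  | cons hadj _ =>
    rw [SimpleGraph.fromRel_adj] at hadj
    obtain ⟨-, ⟨e, h, -⟩ | ⟨e, -, h⟩⟩ := hadj
    exacts [⟨e, Or.inl h⟩, ⟨e, Or.inr h⟩]

theorem exists_inComp_of_ne {a b : T.V} (h : a ≠ b) : ∃ c, T.InComp c a := by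
  obtain ⟨e, he⟩ := T.exists_edge_of_ne h
  exact ⟨T.comp e, e, rfl, he⟩

theorem exists_inComp [Nonempty T.Comp] (a : T.V) : ∃ c, T.InComp c a := by
  obtain ⟨e, -⟩ := T.exists_comp_eq (Classical.arbitrary T.Comp)
  by_cases h : a = T.src e
  · exact ⟨_, h ▸ T.inComp_src e⟩
  · exact T.exists_inComp_of_ne h

/-- Connectedness comes from that of `T`, so being a free product is only a matter of acyclicity. -/
theorem barGraph_preconnected : T.barGraph.Preconnected := by
  classical
  rcases isEmpty_or_nonempty T.Comp with hE | hE
  · rintro (c | a)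
    · exact hE.elim c
    · exact hE.elim a.2.choose
  choose f hf using T.exists_inComp
  have h1 : ∀ c c' a, T.InComp c a → T.InComp c' a →
      T.barGraph.Reachable (Sum.inl c) (Sum.inl c') := by
    intro c c' a h h'
    by_cases hcc : c = c'
    · rw [hcc]
    · have hs : T.IsShared a := ⟨c, c', hcc, h, h'⟩
      exact (T.barGraph_adj_inl_inr (a := ⟨a, hs⟩) |>.2 h).reachable.trans
        (T.barGraph_adj_inr_inl (a := ⟨a, hs⟩) |>.2 h').reachable
  have h2 : ∀ a b, T.barGraph.Reachable (Sum.inl (f a)) (Sum.inl (f b)) :=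
    T.reachable_of_edges _ (fun a => Sum.inl (f a)) fun e =>
      (h1 _ _ _ (hf _) (T.inComp_src e)).trans (h1 _ _ _ (T.inComp_tgt e) (hf _))
  have h3 : ∀ x, ∃ a, T.barGraph.Reachable x (Sum.inl (f a)) := by
    rintro (c | a)
    · obtain ⟨e, rfl⟩ := T.exists_comp_eq c
      exact ⟨_, h1 _ _ _ (T.inComp_src e) (hf _)⟩
    · exact ⟨a, (T.barGraph_adj_inr_inl.2 (hf _)).reachable⟩
  intro x y
  obtain ⟨a, ha⟩ := h3 x
  obtain ⟨b, hb⟩ := h3 y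
  exact ha.trans ((h2 a b).trans hb.symm)

/-- Compared with `barGraph`, this graph has in addition the vertices of `T` that are not shared.
They are not on any cycle, and including them lets every vertex other than the root have a parent
component. -/
theorem incidenceGraph_isTree (h : T.IsFreeProduct) : T.incidenceGraph.IsTree := by
  classical
  obtain ⟨r⟩ := T.connected.nonempty
  have hr : ∀ x, T.incidenceGraph.Reachable (Sum.inr r) x := by
    have h1 : ∀ a b, T.incidenceGraph.Reachable (Sum.inr a) (Sum.inr b) :=
      T.reachable_of_edges _ Sum.inr fun e =>
        (T.incidenceGraph_adj_inr_inl.2 (T.inComp_src e)).reachable.trans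
          (T.incidenceGraph_adj_inl_inr.2 (T.inComp_tgt e)).reachable
    rintro (c | a)
    · obtain ⟨e, rfl⟩ := T.exists_comp_eq c
      exact (h1 _ _).trans (T.incidenceGraph_adj_inr_inl.2 (T.inComp_src e)).reachable
    · exact h1 _ _
  have : Nonempty (T.Comp ⊕ T.V) := ⟨Sum.inr r⟩
  refine ⟨SimpleGraph.Connected.mk fun x y => (hr x).symm.trans (hr y), ?_⟩
  -- A vertex outside `s` belongs to at most one component, so it has at most one neighbour.
  let s : Set (T.Comp ⊕ T.V) := {x | ∀ a, x = Sum.inr a → T.IsShared a}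
  let f : s → T.Comp ⊕ {a : T.V // T.IsShared a} := fun x =>
    match x with
    | ⟨Sum.inl c, _⟩ => Sum.inl c
    | ⟨Sum.inr a, ha⟩ => Sum.inr ⟨a, ha a rfl⟩
  refine h.2.of_forall_isCycle_exists_hom s ⟨f, ?_⟩ ?_ ?_
  · rintro ⟨c | a, hx⟩ ⟨c' | a', hy⟩ hadj
    · exact absurd hadj T.not_incidenceGraph_adj_inl_inl
    · exact T.barGraph_adj_inl_inr.2 (T.incidenceGraph_adj_inl_inr.1 hadj)
    · exact T.barGraph_adj_inr_inl.2 (T.incidenceGraph_adj_inr_inl.1 hadj)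
    · exact absurd hadj T.not_incidenceGraph_adj_inr_inr
  · rintro ⟨c | a, hx⟩ ⟨c' | a', hy⟩ heq
    all_goals simp_all [f]
  · rintro x y z hy hz hyz a rfl
    rcases y with c | b
    · rcases z with c' | b'
      · exact ⟨c, c', fun h => hyz (by rw [h]), T.incidenceGraph_adj_inr_inl.1 hy,
          T.incidenceGraph_adj_inr_inl.1 hz⟩
      · exact absurd hz T.not_incidenceGraph_adj_inr_inr
    · exact absurd hy T.not_incidenceGraph_adj_inr_inr

/-- A tree structure on the colored components, seen from a vertex `r`: `top c` is the vertex of `c`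
closest to `r`, and `parent a` is the component through which `a ≠ r` is reached from `r`. -/
structure Rooting (r : T.V) where
  top : T.Comp → T.V
  parent : ∀ a : T.V, a ≠ r → T.Comp
  depth : T.V → ℕ
  inComp_top : ∀ c, T.InComp c (top c)
  inComp_parent : ∀ a h, T.InComp (parent a h) a
  depth_lt : ∀ a h, depth (top (parent a h)) < depth a
  eq_parent : ∀ c a, T.InComp c a → a ≠ top c → ∃ h, parent a h = c

theorem IsFreeProduct.nonempty_rooting {T : TestGraph (Σ q, J q)} (h : T.IsFreeProduct)
    (r : T.V) : Nonempty (T.Rooting r) := by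
  have hG := T.incidenceGraph_isTree h
  set G := T.incidenceGraph
  have htop : ∀ c : T.Comp, ∃ a, T.InComp c a ∧
      G.dist (Sum.inr r) (Sum.inr a) < G.dist (Sum.inr r) (Sum.inl c) := by
    intro c
    obtain ⟨c' | a, hy, hlt⟩ := SimpleGraph.Connected.exists_adj_dist_lt hG.connected
      (Sum.inr r) (Sum.inl c) (by simp)
    · exact absurd hy T.not_incidenceGraph_adj_inl_inl
    · exact ⟨a, T.incidenceGraph_adj_inl_inr.1 hy, hlt⟩
  have hpar : ∀ a : T.V, a ≠ r → ∃ c, T.InComp c a ∧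
      G.dist (Sum.inr r) (Sum.inl c) < G.dist (Sum.inr r) (Sum.inr a) := by
    intro a ha
    obtain ⟨c | a', hy, hlt⟩ := SimpleGraph.Connected.exists_adj_dist_lt hG.connected
      (Sum.inr r) (Sum.inr a) (by simpa using ha)
    · exact ⟨c, T.incidenceGraph_adj_inr_inl.1 hy, hlt⟩
    · exact absurd hy T.not_incidenceGraph_adj_inr_inr
  choose top h1 h2 using htop
  choose par h3 h4 using hpar
  refine ⟨⟨top, par, fun a => G.dist (Sum.inr r) (Sum.inr a), h1, h3,
    fun a h => (h2 _).trans (h4 a h), fun c a hca hne => ?_⟩⟩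
  have hadj : G.Adj (Sum.inl c) (Sum.inr a) := T.incidenceGraph_adj_inl_inr.2 hca
  have hlt : G.dist (Sum.inr r) (Sum.inl c) < G.dist (Sum.inr r) (Sum.inr a) := by
    -- Adjacent vertices of a tree are at different distances from the root. If `a` were closer than
    -- `c`, then `a` and `top c` would be two neighbours of `c` closer to the root, hence equal.
    by_contra hlt
    have hlt' : G.dist (Sum.inr r) (Sum.inr a) < G.dist (Sum.inr r) (Sum.inl c) :=
      lt_of_le_of_ne (not_lt.1 hlt) (hG.dist_ne_of_adj _ hadj.symm)
    exact hne (Sum.inr_injective (hG.eq_of_dist_lt (Sum.inr r) hadj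
      (T.incidenceGraph_adj_inl_inr.2 (h1 c)) hlt' (h2 c)))
  have har : a ≠ r := by
    rintro rfl
    simp at hlt
  exact ⟨har, Sum.inl_injective (hG.eq_of_dist_lt (Sum.inr r)
    (T.incidenceGraph_adj_inr_inl.2 (h3 a har)) hadj.symm (h4 a har) hlt)⟩

end TestGraph

/-! ### Rooted sums and injective rooted sums of one network. -/

namespace Network

section Terms

variable {J : Type u} {V : Type v}

/-- The contribution of the map `φ` to the rooted sum. -/
noncomputable def weight (N : Network J V) (T : TestGraph J) (φ : T.V → V) : ℂ :=
  ∏ e, N.entry (T.lab e) (T.star e) (φ (T.src e)) (φ (T.tgt e))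

open Classical in
/-- The contribution of the map `φ` to the rooted sum, zero if `φ` is not admissible. -/
noncomputable def term (N : Network J V) (T : TestGraph J) (r : T.V) (φ : T.V → V) : ℂ :=
  if (∀ a, φ a ∈ N.verts) ∧ φ r = N.root then N.weight T φ else 0

open Classical in
/-- The contribution of the map `φ` to the injective rooted sum. -/
noncomputable def injTerm (N : Network J V) (T : TestGraph J) (r : T.V) (φ : T.V → V) : ℂ :=
  if Function.Injective φ then N.term T r φ else 0

/-- The sum over the injective maps that send `r` to the root. -/
noncomputable def injSum (N : Network J V) (T : TestGraph J) (r : T.V) : ℂ :=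
  ∑' φ, N.injTerm T r φ

theorem entry_ne_zero {N : Network J V} {j : J} {s : Bool} {a b : V} (h : N.entry j s a b ≠ 0) :
    N.A j a b ≠ 0 ∨ N.A j b a ≠ 0 := by
  unfold entry at h
  split_ifs at h
  · exact Or.inr fun h' => h (by rw [h', map_zero])
  · exact Or.inl h

theorem entry_not (N : Network J V) (j : J) (s : Bool) (a b : V) :
    N.entry j (!s) b a = conj (N.entry j s a b) := by
  cases s <;> simp [entry]

theorem weight_ne_zero {N : Network J V} {T : TestGraph J} {φ : T.V → V}
    (h : N.weight T φ ≠ 0) (e : T.E) :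
    N.entry (T.lab e) (T.star e) (φ (T.src e)) (φ (T.tgt e)) ≠ 0 :=
  Finset.prod_ne_zero_iff.1 h e (Finset.mem_univ e)

theorem term_ne_zero {N : Network J V} {T : TestGraph J} {r : T.V} {φ : T.V → V} :
    N.term T r φ ≠ 0 ↔ (∀ a, φ a ∈ N.verts) ∧ φ r = N.root ∧ N.weight T φ ≠ 0 := by
  classical
  unfold term
  rw [ite_ne_right_iff, and_assoc]

theorem injTerm_ne_zero {N : Network J V} {T : TestGraph J} {r : T.V} {φ : T.V → V} :
    N.injTerm T r φ ≠ 0 ↔ Function.Injective φ ∧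
      (∀ a, φ a ∈ N.verts) ∧ φ r = N.root ∧ N.weight T φ ≠ 0 := by
  classical
  unfold injTerm
  rw [ite_ne_right_iff, term_ne_zero]

/-- The image of `r` is fixed, and local finiteness propagates finiteness of the possible images
along walks from `r`. -/
theorem finite_support_term (N : Network J V) (T : TestGraph J) (r : T.V) :
    (Function.support (N.term T r)).Finite := by
  have key : ∀ a, {x | ∃ φ, N.term T r φ ≠ 0 ∧ φ a = x}.Finite := by
    have step : ∀ (e : T.E) (a b : T.V), (T.src e = a ∧ T.tgt e = b ∨ T.src e = b ∧ T.tgt e = a) →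
        {x | ∃ φ, N.term T r φ ≠ 0 ∧ φ a = x}.Finite →
        {x | ∃ φ, N.term T r φ ≠ 0 ∧ φ b = x}.Finite := by
      intro e a b hab hfin
      refine (hfin.biUnion fun x _ => N.locallyFinite (T.lab e) x).subset ?_
      rintro y ⟨φ, hφ, rfl⟩
      refine Set.mem_biUnion (x := φ a) ⟨φ, hφ, rfl⟩ ?_
      have := entry_ne_zero (weight_ne_zero (term_ne_zero.1 hφ).2.2 e)
      rcases hab with ⟨rfl, rfl⟩ | ⟨rfl, rfl⟩
      · exact this
      · exact this.symm
    intro a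
    obtain ⟨p⟩ := T.connected.preconnected r a
    have : ∀ (b : T.V), (SimpleGraph.fromRel (fun a b : T.V => ∃ e, T.src e = a ∧ T.tgt e = b)).Walk
        b a → {x | ∃ φ, N.term T r φ ≠ 0 ∧ φ b = x}.Finite →
        {x | ∃ φ, N.term T r φ ≠ 0 ∧ φ a = x}.Finite := by
      intro b p
      induction p with
      | nil => exact id
      | cons hadj _ ih =>
        intro h
        rw [SimpleGraph.fromRel_adj] at hadj
        obtain ⟨-, ⟨e, he⟩ | ⟨e, he⟩⟩ := hadj
        · exact ih p (step e _ _ (Or.inl he) h)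
        · exact ih p (step e _ _ (Or.inr he) h)
    refine this r p ((Set.finite_singleton N.root).subset ?_)
    rintro x ⟨φ, hφ, rfl⟩
    exact (term_ne_zero.1 hφ).2.1
  refine (Set.Finite.pi' key).subset fun φ hφ a => ⟨φ, hφ, rfl⟩

theorem support_injTerm_subset (N : Network J V) (T : TestGraph J) (r : T.V) :
    Function.support (N.injTerm T r) ⊆ Function.support (N.term T r) := by
  classical
  intro φ hφ
  exact (ite_ne_right_iff.1 hφ).2

theorem finite_support_injTerm (N : Network J V) (T : TestGraph J) (r : T.V) :
    (Function.support (N.injTerm T r)).Finite :=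
  (N.finite_support_term T r).subset (N.support_injTerm_subset T r)

theorem rootedSum_eq_tsum (N : Network J V) (T : TestGraph J) (r : T.V) :
    N.rootedSum T r = ∑' φ, N.term T r φ := by
  rw [tsum_eq_finsum (N.finite_support_term T r)]
  unfold rootedSum
  refine finsum_congr fun φ => ?_
  classical
  rw [finsum_eq_if]
  unfold term weight
  congr

/-- A map with kernel `π` is an injective map on the quotient, and the weights agree because `T.quot
π` keeps all the edges. -/
theorem tsum_ker_eq_injSum_quot (N : Network J V) (T : TestGraph J) (r : T.V) (π : Setoid T.V)
    [∀ φ : T.V → V, Decidable (Setoid.ker φ = π)] :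
    ∑' φ, (if Setoid.ker φ = π then N.term T r φ else 0) =
      N.injSum (T.quot π) (Quotient.mk π r) := by
  have hinj : Function.Injective
      (fun (ψ : (T.quot π).V → V) (a : T.V) => ψ (Quotient.mk π a)) := by
    intro ψ ψ' h
    funext x
    obtain ⟨a, rfl⟩ := Quotient.mk_surjective x
    exact congrFun h a
  classical
  unfold injSum
  rw [← hinj.tsum_eq]
  · refine tsum_congr fun ψ => ?_
    have h1 : Setoid.ker (fun a : T.V => ψ (Quotient.mk π a)) = π ↔ Function.Injective ψ := by
      constructor
      · intro h x y hxy
        obtain ⟨a, rfl⟩ := Quotient.mk_surjective x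
        obtain ⟨b, rfl⟩ := Quotient.mk_surjective y
        refine Quotient.sound ?_
        have : Setoid.ker (fun a : T.V => ψ (Quotient.mk π a)) a b := hxy
        rwa [h] at this
      · intro h
        ext a b
        exact ⟨fun hab => Quotient.exact (h hab), fun hab => congrArg ψ (Quotient.sound hab)⟩
    have h2 : N.term (T.quot π) (Quotient.mk π r) ψ =
        N.term T r (fun a => ψ (Quotient.mk π a)) := by
      unfold term
      refine if_congr (and_congr_left' ⟨fun h a => h _, fun h x => ?_⟩) rfl rfl
      obtain ⟨a, rfl⟩ := Quotient.mk_surjective x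
      exact h a
    unfold injTerm
    rw [h2]
    exact if_congr h1 rfl rfl
  · intro φ hφ
    have hk : Setoid.ker φ = π := (ite_ne_right_iff.1 hφ).1
    refine ⟨Quotient.lift φ (fun a b hab => ?_), rfl⟩
    have : π a b := hab
    rw [← hk] at this
    exact this

/-- Maps are sorted by their kernel. This is the relation between `τ` and `τ⁰`, for a fixed network
and before expectations. -/
theorem rootedSum_eq_injSum_add (N : Network J V) (T : TestGraph J) (r : T.V) :
    N.rootedSum T r = N.injSum T r +
      ∑ π : {π : Setoid T.V // π ≠ ⊥}, N.injSum (T.quot π.1) (Quotient.mk π.1 r) := by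
  classical
  let : Fintype (Setoid T.V) := Fintype.ofFinite _
  have h1 : ∀ φ, N.term T r φ = ∑ π : Setoid T.V, if Setoid.ker φ = π then N.term T r φ else 0 := by
    intro φ
    rw [Finset.sum_ite_eq]
    simp
  rw [rootedSum_eq_tsum, tsum_congr h1, Summable.tsum_finsetSum]
  · rw [Fintype.sum_eq_add_sum_subtype_ne _ (⊥ : Setoid T.V)]
    congr 1
    · refine tsum_congr fun φ => ?_
      unfold injTerm
      refine if_congr ?_ rfl rfl
      exact (Setoid.injective_iff_ker_bot φ).symm
    · refine Finset.sum_congr (by congr!) fun π _ => N.tsum_ker_eq_injSum_quot T r π.1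
  · intro π _
    refine summable_of_hasFiniteSupport ((N.finite_support_term T r).subset fun φ hφ => ?_)
    exact (ite_ne_right_iff.1 hφ).2

/-- As `T` is connected, a map of nonzero weight that sends `r` to the root cannot leave the
component of the root. -/
theorem term_rootComponent (N : Network J V) (T : TestGraph J) (r : T.V) (φ : T.V → V) :
    N.rootComponent.term T r φ = N.term T r φ := by
  classical
  by_cases h : ∀ a, N.graph.Reachable N.root (φ a)
  · unfold term weight entry rootComponent
    simp only [h, and_self, if_true]
    refine if_congr (and_congr_left' (forall_congr' fun a => ?_)) rfl rfl
    exact ⟨fun h => h.1, fun h' => ⟨h', h a⟩⟩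
  · have h1 : N.rootComponent.term T r φ = 0 := by
      by_contra h0
      exact h fun a => ((term_ne_zero.1 h0).1 a).2
    have h2 : N.term T r φ = 0 := by
      by_contra h0
      obtain ⟨-, hr, hw⟩ := term_ne_zero.1 h0
      refine h fun a => hr ▸ T.reachable_of_edges N.graph φ (fun e => ?_) r a
      by_cases hab : φ (T.src e) = φ (T.tgt e)
      · rw [hab]
      · refine SimpleGraph.Adj.reachable ((SimpleGraph.fromRel_adj _ _ _).2 ⟨hab, ?_⟩)
        exact (entry_ne_zero (weight_ne_zero hw e)).imp (fun h => ⟨_, h⟩) (fun h => ⟨_, h⟩)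
    rw [h1, h2]

theorem rootedSum_rootComponent (N : Network J V) (T : TestGraph J) (r : T.V) :
    N.rootComponent.rootedSum T r = N.rootedSum T r := by
  simp_rw [rootedSum_eq_tsum, term_rootComponent]

end Terms

end Network

/-! ### Doubling a test graph. -/

namespace TestGraph

open Classical in
/-- The map from `T` to the second copy of `T` in `T.double r`. -/
noncomputable def doubleInr {J : Type u} (T : TestGraph J) (r a : T.V) : T.V ⊕ {a : T.V // a ≠ r} :=
  if h : a = r then Sum.inl r else Sum.inr ⟨a, h⟩

/-- The amalgamation at `r` of `T` and of its adjoint. -/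
noncomputable def double {J : Type u} (T : TestGraph J) (r : T.V) : TestGraph J where
  V := T.V ⊕ {a : T.V // a ≠ r}
  E := T.E ⊕ T.E
  fintypeV := Fintype.ofFinite _
  fintypeE := inferInstance
  src := Sum.elim (fun e => Sum.inl (T.src e)) (fun e => T.doubleInr r (T.tgt e))
  tgt := Sum.elim (fun e => Sum.inl (T.tgt e)) (fun e => T.doubleInr r (T.src e))
  lab := Sum.elim T.lab T.lab
  star := Sum.elim T.star (fun e => !T.star e)
  connected := by
    set s : T.E ⊕ T.E → T.V ⊕ {a : T.V // a ≠ r} :=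
      Sum.elim (fun e => Sum.inl (T.src e)) (fun e => T.doubleInr r (T.tgt e)) with hs
    set t : T.E ⊕ T.E → T.V ⊕ {a : T.V // a ≠ r} :=
      Sum.elim (fun e => Sum.inl (T.tgt e)) (fun e => T.doubleInr r (T.src e)) with ht
    have : Nonempty (T.V ⊕ {a : T.V // a ≠ r}) := ⟨Sum.inl r⟩
    have base : ∀ x, (SimpleGraph.fromRel (fun a b => ∃ e, s e = a ∧ t e = b)).Reachable
        (Sum.inl r) x := by
      rintro (a | ⟨a, ha⟩)
      · exact T.reachable_of_edges _ Sum.inl (fun e => reachable_src_tgt s t (Sum.inl e)) r a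
      · have := T.reachable_of_edges _ (T.doubleInr r)
          (fun e => (reachable_src_tgt s t (Sum.inr e)).symm) r a
        simpa [doubleInr, ha] using this
    exact SimpleGraph.Connected.mk fun x y => (base x).symm.trans (base y)

/-- The vertex of `T.double r` where the two copies are amalgamated. -/
noncomputable def doubleRoot {J : Type u} (T : TestGraph J) (r : T.V) : (T.double r).V :=
  Sum.inl r

end TestGraph

namespace Network

open Classical in
theorem term_double {J : Type u} {V : Type v} (N : Network J V) (T : TestGraph J) (r : T.V)
    (Φ : (T.double r).V → V) :
    N.term (T.double r) (T.doubleRoot r) Φ =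
      N.term T r (fun a => Φ (Sum.inl a)) * conj (N.term T r (fun a => Φ (T.doubleInr r a))) := by
  have hr : T.doubleInr r r = Sum.inl r := by simp [TestGraph.doubleInr]
  have hw : N.weight (T.double r) Φ = N.weight T (fun a => Φ (Sum.inl a)) *
      conj (N.weight T (fun a => Φ (T.doubleInr r a))) := by
    unfold weight
    rw [map_prod]
    refine (Fintype.prod_sum_type _).trans (congrArg₂ _ rfl (Finset.prod_congr rfl fun e _ => ?_))
    exact N.entry_not _ _ _ _
  have hv : (∀ a, Φ a ∈ N.verts) ↔
      (∀ a, Φ (Sum.inl a) ∈ N.verts) ∧ ∀ a, Φ (T.doubleInr r a) ∈ N.verts := by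
    refine ⟨fun h => ⟨fun a => h _, fun a => h _⟩, fun h => ?_⟩
    rintro (a | ⟨a, ha⟩)
    · exact h.1 a
    · simpa [TestGraph.doubleInr, ha] using h.2 a
  unfold term TestGraph.doubleRoot
  rw [hw]
  simp only [hv, hr]
  by_cases h1 : ∀ a, Φ (Sum.inl a) ∈ N.verts <;>
    by_cases h2 : ∀ a, Φ (T.doubleInr r a) ∈ N.verts <;>
    by_cases h3 : Φ (Sum.inl r) = N.root <;> simp [h1, h2, h3]

/-- The second moment of a rooted sum is thus the expectation of another rooted sum, which later
supplies uniform integrability. -/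
theorem rootedSum_double {J : Type u} {V : Type v} (N : Network J V) (T : TestGraph J) (r : T.V) :
    N.rootedSum (T.double r) (T.doubleRoot r) = N.rootedSum T r * conj (N.rootedSum T r) := by
  classical
  have hr : T.doubleInr r r = Sum.inl r := by simp [TestGraph.doubleInr]
  have hfin := N.finite_support_term T r
  have hs1 : Summable fun φ => ‖N.term T r φ‖ :=
    summable_of_hasFiniteSupport (hfin.subset fun φ hφ => norm_ne_zero_iff.1 hφ)
  have hs2 : Summable fun φ => ‖conj (N.term T r φ)‖ := by simpa using hs1
  rw [rootedSum_eq_tsum, rootedSum_eq_tsum, Complex.conj_tsum,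
    tsum_mul_tsum_of_summable_norm hs1 hs2]
  let g : ((T.double r).V → V) → (T.V → V) × (T.V → V) := fun Φ =>
    (fun a => Φ (Sum.inl a), fun a => Φ (T.doubleInr r a))
  have hg : Function.Injective g := by
    intro Φ Ψ h
    funext a
    rcases a with a | ⟨a, ha⟩
    · exact congrFun (congrArg Prod.fst h) a
    · have := congrFun (congrArg Prod.snd h) a
      simpa [g, TestGraph.doubleInr, ha] using this
  rw [← hg.tsum_eq]
  · exact tsum_congr fun Φ => N.term_double T r Φ
  -- Both maps of a contributing pair send `r` to the root, so they can be amalgamated at `r`.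
  · rintro ⟨φ, ψ⟩ h
    have h1 := (term_ne_zero.1 (left_ne_zero_of_mul h)).2.1
    have h2 := (term_ne_zero.1 ((map_ne_zero _).1 (right_ne_zero_of_mul h))).2.1
    refine ⟨Sum.elim φ (fun a => ψ a.1), Prod.ext rfl (funext fun a => ?_)⟩
    by_cases ha : a = r
    · subst ha
      simpa [g, hr] using h1.trans h2.symm
    · simp [g, TestGraph.doubleInr, ha]

end Network

/-! ### Words as vertices of the glued network. -/

namespace Network

section GlueBasic

variable {ι : Type w} {J : ι → Type u} {V : ι → Type v}

theorem length_of_mem_generation {X : ∀ i : List (Σ q, V q) × ι, Network (J i.2) (V i.2)} {m : ℕ}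
    {y : List (Σ q, V q)} (h : y ∈ generation X m) : y.length = m := by
  induction m generalizing y with
  | zero => simpa using congrArg List.length (show y = [] from h)
  | succ m ih =>
    obtain ⟨x, hx, q, a, -, -, -, rfl⟩ := h
    simp [ih hx]

/-- The words that are vertices of the glued network. -/
def IsWord (X : ∀ i : List (Σ q, V q) × ι, Network (J i.2) (V i.2)) (y : List (Σ q, V q)) : Prop :=
  y ∈ generation X y.length

theorem mem_generation_iff {X : ∀ i : List (Σ q, V q) × ι, Network (J i.2) (V i.2)} {m : ℕ}
    {y : List (Σ q, V q)} : y ∈ generation X m ↔ IsWord X y ∧ y.length = m := by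
  refine ⟨fun h => ?_, fun h => h.2 ▸ h.1⟩
  have := length_of_mem_generation h
  exact ⟨by rw [IsWord, this]; exact h, this⟩

theorem isWord_nil (X : ∀ i : List (Σ q, V q) × ι, Network (J i.2) (V i.2)) : IsWord X [] := rfl

theorem isWord_cons {X : ∀ i : List (Σ q, V q) × ι, Network (J i.2) (V i.2)} {q : ι} {a : V q}
    {x : List (Σ q, V q)} : IsWord X (⟨q, a⟩ :: x) ↔
      IsWord X x ∧ (∀ l ∈ x.head?, l.1 ≠ q) ∧ a ∈ (X (x, q)).verts ∧ a ≠ (X (x, q)).root := by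
  constructor
  · rintro ⟨x', hx', q', a', h1, h2, h3, h4⟩
    simp only [List.cons.injEq, Sigma.mk.injEq] at h4
    obtain ⟨⟨rfl, h⟩, rfl⟩ := h4
    obtain rfl := eq_of_heq h
    exact ⟨(mem_generation_iff.1 hx').1, h1, h2, h3⟩
  · rintro ⟨hx, h1, h2, h3⟩
    exact ⟨x, hx, q, a, h1, h2, h3, rfl⟩

theorem base_cons_self {q : ι} (a : V q) (x : List (Σ q, V q)) : base q (⟨q, a⟩ :: x) = x := by
  simp [base]

theorem position_cons_self (X : ∀ i : List (Σ q, V q) × ι, Network (J i.2) (V i.2)) {q : ι}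
    (a : V q) (x : List (Σ q, V q)) : position X q (⟨q, a⟩ :: x) = a := by
  simp [position]

theorem base_eq_self {q : ι} {y : List (Σ q, V q)} (h : ∀ l ∈ y.head?, l.1 ≠ q) :
    base q y = y := by
  cases y with
  | nil => rfl
  | cons l x => simp [base, h l (by simp)]

theorem position_eq_root (X : ∀ i : List (Σ q, V q) × ι, Network (J i.2) (V i.2)) {q : ι}
    {y : List (Σ q, V q)} (h : ∀ l ∈ y.head?, l.1 ≠ q) : position X q y = (X (y, q)).root := by
  cases y with
  | nil => rfl
  | cons l x => simp [position, h l (by simp)]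

theorem head_ne_or_eq_cons (q : ι) (y : List (Σ q, V q)) :
    (∀ l ∈ y.head?, l.1 ≠ q) ∨ ∃ (a : V q) (x : List (Σ q, V q)), y = ⟨q, a⟩ :: x := by
  rcases y with _ | ⟨⟨q', a⟩, x⟩
  · simp
  · by_cases h : q' = q
    · subst h
      exact Or.inr ⟨a, x, rfl⟩
    · simp [h]

theorem head_ne_of_base_eq_self {q : ι} {y : List (Σ q, V q)} (h : base q y = y) :
    ∀ l ∈ y.head?, l.1 ≠ q := by
  rcases head_ne_or_eq_cons q y with h' | ⟨a, x, rfl⟩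
  · exact h'
  · rw [base_cons_self] at h
    simpa using congrArg List.length h

theorem length_base (q : ι) (y : List (Σ q, V q)) :
    base q y = y ∨ (base q y).length + 1 = y.length := by
  rcases head_ne_or_eq_cons q y with h | ⟨a, x, rfl⟩
  · exact Or.inl (base_eq_self h)
  · rw [base_cons_self]
    simp

theorem IsWord.position_mem {X : ∀ i : List (Σ q, V q) × ι, Network (J i.2) (V i.2)}
    {y : List (Σ q, V q)} (h : IsWord X y) (q : ι) :
    position X q y ∈ (X (base q y, q)).verts := by
  rcases head_ne_or_eq_cons q y with h' | ⟨a, x, rfl⟩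
  · rw [position_eq_root X h', base_eq_self h']
    exact (X (y, q)).root_mem
  · rw [position_cons_self, base_cons_self]
    exact (isWord_cons.1 h).2.2.1

/-- A letter of a word is never the root of its copy, so the root position in a copy is taken only
by the vertex to which the copy is attached. -/
theorem IsWord.ext {X : ∀ i : List (Σ q, V q) × ι, Network (J i.2) (V i.2)}
    {y z : List (Σ q, V q)} (hy : IsWord X y) (hz : IsWord X z) (q : ι)
    (hb : base q y = base q z) (hp : position X q y = position X q z) : y = z := by
  rcases head_ne_or_eq_cons q y with h | ⟨a, x, rfl⟩ <;>
    rcases head_ne_or_eq_cons q z with h' | ⟨a', x', rfl⟩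
  · rwa [base_eq_self h, base_eq_self h'] at hb
  · rw [base_eq_self h, base_cons_self] at hb
    subst hb
    rw [position_eq_root X h, position_cons_self] at hp
    exact absurd hp.symm (isWord_cons.1 hz).2.2.2
  · rw [base_eq_self h', base_cons_self] at hb
    subst hb
    rw [position_eq_root X h', position_cons_self] at hp
    exact absurd hp (isWord_cons.1 hy).2.2.2
  · rw [position_cons_self, position_cons_self] at hp
    rw [base_cons_self, base_cons_self] at hb
    rw [hp, hb]

theorem mem_verts_glue {X : ∀ i : List (Σ q, V q) × ι, Network (J i.2) (V i.2)} {n : ℕ∞}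
    {y : List (Σ q, V q)} : y ∈ (glue X n).verts ↔ IsWord X y ∧ (y.length : ℕ∞) ≤ n := by
  constructor
  · rintro ⟨m, hm, hy⟩
    obtain ⟨h, rfl⟩ := mem_generation_iff.1 hy
    exact ⟨h, hm⟩
  · rintro ⟨h, hm⟩
    exact ⟨_, hm, h⟩

theorem mem_verts_glue_top {X : ∀ i : List (Σ q, V q) × ι, Network (J i.2) (V i.2)}
    {y : List (Σ q, V q)} : y ∈ (glue X ⊤).verts ↔ IsWord X y := by
  simp [mem_verts_glue]

open Classical in
theorem glue_A (X : ∀ i : List (Σ q, V q) × ι, Network (J i.2) (V i.2)) (n : ℕ∞) (c : Σ q, J q)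
    (x y : List (Σ q, V q)) : (glue X n).A c x y =
      if (x ∈ (glue X n).verts ∧ y ∈ (glue X n).verts) ∧ base c.1 x = base c.1 y ∧
        ((base c.1 x).length : ℕ∞) < n then
      (X (base c.1 x, c.1)).A c.2 (position X c.1 x) (position X c.1 y)
    else 0 := rfl

open Classical in
theorem glue_top_entry (X : ∀ i : List (Σ q, V q) × ι, Network (J i.2) (V i.2)) (c : Σ q, J q)
    (s : Bool) (x y : List (Σ q, V q)) : (glue X ⊤).entry c s x y =
      if (IsWord X x ∧ IsWord X y) ∧ base c.1 x = base c.1 y then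
        (X (base c.1 x, c.1)).entry c.2 s (position X c.1 x) (position X c.1 y) else 0 := by
  unfold entry
  simp only [glue_A, mem_verts_glue_top, ENat.natCast_lt_top, and_true]
  by_cases hb : base c.1 x = base c.1 y
  · by_cases hx : IsWord X x <;> by_cases hy : IsWord X y <;> cases s <;>
      simp only [hb, hx, hy] <;> simp <;> rw [hb]
  · cases s <;> simp [hb, Ne.symm hb]

end GlueBasic

/-! ### Injective maps into the glued network and positions of the colored components. -/

section Word

variable {ι : Type w} {J : ι → Type u} {V : ι → Type v} {T : TestGraph (Σ q, J q)} {r : T.V}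

theorem weight_glue (X : ∀ i : List (Σ q, V q) × ι, Network (J i.2) (V i.2))
    (T : TestGraph (Σ q, J q)) (φ : T.V → List (Σ q, V q)) :
    (glue X ⊤).weight T φ = ∏ c : T.Comp, ∏ e : (T.compGraph c).E,
      (glue X ⊤).entry (T.lab e.1) (T.star e.1) (φ (T.src e.1)) (φ (T.tgt e.1)) := by
  classical
  unfold weight
  rw [← Finset.prod_fiberwise Finset.univ T.comp]
  refine Finset.prod_congr rfl fun c _ => ?_
  refine Finset.prod_subtype _ (fun e => ?_) _
  simp

theorem entry_compGraph (X : ∀ i : List (Σ q, V q) × ι, Network (J i.2) (V i.2))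
    (c : T.Comp) (e : (T.compGraph c).E) (x : List (Σ q, V q)) (s : Bool)
    (y z : List (Σ q, V q)) :
    (X (x, T.color c)).entry ((T.compGraph c).lab e) s (position X (T.color c) y)
      (position X (T.color c) z) =
    (X (x, (T.lab e.1).1)).entry (T.lab e.1).2 s (position X (T.lab e.1).1 y)
      (position X (T.lab e.1).1 z) := by
  obtain ⟨e, rfl⟩ := e
  rfl

theorem color_eq (c : T.Comp) (e : (T.compGraph c).E) : (T.lab e.1).1 = T.color c := by
  obtain ⟨e, rfl⟩ := e
  rfl

/-- An edge of nonzero weight joins vertices of a same copy. A colored component is connected by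
edges of one color, hence lies in one copy. -/
theorem base_eq_of_inComp {X : ∀ i : List (Σ q, V q) × ι, Network (J i.2) (V i.2)}
    {φ : T.V → List (Σ q, V q)} (h : (glue X ⊤).weight T φ ≠ 0) {c : T.Comp} {a b : T.V}
    (ha : T.InComp c a) (hb : T.InComp c b) :
    base (T.color c) (φ a) = base (T.color c) (φ b) := by
  classical
  have := (T.compGraph c).reachable_of_edges ⊥ (fun a => base (T.color c) (φ a.1))
    (fun e => ?_) ⟨a, ha⟩ ⟨b, hb⟩
  · rwa [SimpleGraph.reachable_bot] at this
  · rw [SimpleGraph.reachable_bot]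
    have he := weight_ne_zero h e.1
    rw [glue_top_entry] at he
    have := (ite_ne_right_iff.1 he).1.2
    rwa [color_eq c e] at this

theorem isFreeProduct_of_weight_ne_zero
    {X : ∀ i : List (Σ q, V q) × ι, Network (J i.2) (V i.2)}
    {φ : T.V → List (Σ q, V q)} (hφ : Function.Injective φ) (h : (glue X ⊤).weight T φ ≠ 0) :
    T.IsFreeProduct := by
  refine ⟨T.barGraph_preconnected, ?_⟩
  have hin : ∀ c : T.Comp, ∃ a, T.InComp c a := fun c => by
    obtain ⟨e, rfl⟩ := T.exists_comp_eq c
    exact ⟨_, T.inComp_src e⟩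
  choose rep hrep using hin
  -- The height places a component halfway between the root of its copy (word of length `ℓ`) and the
  -- other vertices of the copy (length `ℓ + 1`). Below a component there is only the vertex sent to
  -- the root of the copy, by injectivity of `φ`; below a vertex there is only the component with
  -- the color of its first letter.
  refine SimpleGraph.isAcyclic_of_unique_le (Sum.elim
    (fun c => 2 * (base (T.color c) (φ (rep c))).length + 1) (fun a => 2 * (φ a.1).length)) ?_
  rintro (c | a) (c' | a') (c'' | a'') hy hz hfy hfz
  all_goals first
    | exact absurd hy T.not_barGraph_adj_inl_inl
    | exact absurd hz T.not_barGraph_adj_inl_inl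
    | exact absurd hy T.not_barGraph_adj_inr_inr
    | exact absurd hz T.not_barGraph_adj_inr_inr
    | skip
  · rw [T.barGraph_adj_inl_inr] at hy hz
    have key : ∀ b : {a : T.V // T.IsShared a}, T.InComp c b.1 →
        2 * (φ b.1).length ≤ 2 * (base (T.color c) (φ (rep c))).length + 1 →
        φ b.1 = base (T.color c) (φ (rep c)) := by
      intro b hb hle
      rw [base_eq_of_inComp h (hrep c) hb] at hle ⊢
      rcases length_base (T.color c) (φ b.1) with h | h
      · exact h.symm
      · omega
    exact congrArg Sum.inr (Subtype.ext (hφ ((key _ hy hfy).trans (key _ hz hfz).symm)))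
  · rw [T.barGraph_adj_inr_inl] at hy hz
    have key : ∀ c : T.Comp, T.InComp c a.1 →
        2 * (base (T.color c) (φ (rep c))).length + 1 ≤ 2 * (φ a.1).length →
        ∃ b x, φ a.1 = ⟨T.color c, b⟩ :: x := by
      intro c hc hle
      rw [base_eq_of_inComp h (hrep c) hc] at hle
      rcases head_ne_or_eq_cons (T.color c) (φ a.1) with h | h
      · rw [base_eq_self h] at hle
        omega
      · exact h
    obtain ⟨b, x, h1⟩ := key _ hy hfy
    obtain ⟨b', x', h2⟩ := key _ hz hfz
    rw [h1] at h2
    exact congrArg Sum.inl (hy.eq_of_color_eq hz (congrArg Sigma.fst (List.cons.inj h2).1))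

open Classical in
/-- The positions of the vertices of `T` in the glued network, given their positions in the copies
in which the colored components are. -/
noncomputable def word (ρ : T.Rooting r) (f : ∀ c, (T.compGraph c).V → V (T.color c)) (a : T.V) :
    List (Σ q, V q) :=
  if h : a = r then [] else
    ⟨T.color (ρ.parent a h), f (ρ.parent a h) ⟨a, ρ.inComp_parent a h⟩⟩ ::
      word ρ f (ρ.top (ρ.parent a h))
termination_by ρ.depth a
decreasing_by exact ρ.depth_lt a h

theorem word_root (ρ : T.Rooting r) (f : ∀ c, (T.compGraph c).V → V (T.color c)) :
    word ρ f r = [] := by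
  rw [word]; simp

theorem word_of_ne_root (ρ : T.Rooting r) (f : ∀ c, (T.compGraph c).V → V (T.color c)) {a : T.V}
    (h : a ≠ r) : word ρ f a =
      ⟨T.color (ρ.parent a h), f (ρ.parent a h) ⟨a, ρ.inComp_parent a h⟩⟩ ::
      word ρ f (ρ.top (ρ.parent a h)) := by
  rw [word]; simp [h]

theorem word_of_ne_top (ρ : T.Rooting r) (f : ∀ c, (T.compGraph c).V → V (T.color c)) {c : T.Comp}
    {a : T.V} (ha : T.InComp c a) (h : a ≠ ρ.top c) :
    word ρ f a = ⟨T.color c, f c ⟨a, ha⟩⟩ :: word ρ f (ρ.top c) := by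
  obtain ⟨har, rfl⟩ := ρ.eq_parent c a ha h
  exact word_of_ne_root ρ f har

/-- Two components of the same color sharing a vertex coincide, and then the depth would be less
than itself. This makes consecutive letters of `word` have different colors. -/
theorem color_parent_top_ne (ρ : T.Rooting r) (c : T.Comp) (h : ρ.top c ≠ r) :
    T.color (ρ.parent (ρ.top c) h) ≠ T.color c := by
  intro hc
  have h1 := ρ.depth_lt (ρ.top c) h
  rw [(ρ.inComp_parent (ρ.top c) h).eq_of_color_eq (ρ.inComp_top c) hc] at h1
  exact lt_irrefl _ h1

theorem head_word_top (ρ : T.Rooting r) (f : ∀ c, (T.compGraph c).V → V (T.color c)) (c : T.Comp) :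
    ∀ l ∈ (word ρ f (ρ.top c)).head?, l.1 ≠ T.color c := by
  by_cases h : ρ.top c = r
  · rw [h, word_root]
    simp
  · rw [word_of_ne_root ρ f h]
    simpa using color_parent_top_ne ρ c h

theorem base_word (ρ : T.Rooting r) (f : ∀ c, (T.compGraph c).V → V (T.color c)) {c : T.Comp}
    {a : T.V} (ha : T.InComp c a) : base (T.color c) (word ρ f a) = word ρ f (ρ.top c) := by
  by_cases h : a = ρ.top c
  · rw [h, base_eq_self (head_word_top ρ f c)]
  · rw [word_of_ne_top ρ f ha h, base_cons_self]

theorem word_injective (ρ : T.Rooting r) {f : ∀ c, (T.compGraph c).V → V (T.color c)}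
    (hf : ∀ c, Function.Injective (f c)) : Function.Injective (word ρ f) := by
  have key : ∀ n a b, ρ.depth a < n → word ρ f a = word ρ f b → a = b := by
    intro n
    induction n with
    | zero => intro a b h; omega
    | succ n ih =>
      intro a b hn hab
      by_cases ha : a = r <;> by_cases hb : b = r
      · rw [ha, hb]
      · rw [ha, word_root, word_of_ne_root ρ f hb] at hab
        cases hab
      · rw [hb, word_root, word_of_ne_root ρ f ha] at hab
        cases hab
      · have hab' := hab
        rw [word_of_ne_root ρ f ha, word_of_ne_root ρ f hb] at hab'
        have h1 := congrArg Sigma.fst (List.cons.inj hab').1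
        have h2 := ih _ _ (lt_of_lt_of_le (ρ.depth_lt a ha) (Nat.lt_succ_iff.1 hn))
          (List.cons.inj hab').2
        -- The tails give the same top vertex and the first letters the same color, which determines
        -- the component. Injectivity of `f` on it then concludes.
        have h3 : ρ.parent a ha = ρ.parent b hb :=
          (ρ.inComp_top (ρ.parent a ha)).eq_of_color_eq
            (h2 ▸ ρ.inComp_top (ρ.parent b hb)) h1
        have hca : T.InComp (ρ.parent b hb) a := h3 ▸ ρ.inComp_parent a ha
        have hna : a ≠ ρ.top (ρ.parent b hb) := by
          rw [← h3]
          intro h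
          have := ρ.depth_lt a ha
          rw [← h] at this
          exact lt_irrefl _ this
        rw [word_of_ne_top ρ f hca hna, word_of_ne_root ρ f hb] at hab
        have h4 := eq_of_heq (Sigma.mk.inj (List.cons.inj hab).1).2
        exact congrArg Subtype.val (hf _ h4)
  exact fun a b => key _ a b (Nat.lt_succ_self _)

/-- This is the source of independence: for fixed positions `f`, the components use distinct copies,
whose indices do not depend on the sample. -/
theorem word_top_injective (ρ : T.Rooting r) {f : ∀ c, (T.compGraph c).V → V (T.color c)}
    (hf : ∀ c, Function.Injective (f c)) :
    Function.Injective (fun c => (word ρ f (ρ.top c), T.color c)) := by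
  intro c c' h
  obtain ⟨h1, h2⟩ := Prod.mk.inj h
  have h3 := word_injective ρ hf h1
  exact (ρ.inComp_top c).eq_of_color_eq (h3 ▸ ρ.inComp_top c') h2

/-- The product over the colored components of the contributions of the families of positions. -/
noncomputable def prodTerm (X : ∀ i : List (Σ q, V q) × ι, Network (J i.2) (V i.2))
    (ρ : T.Rooting r) (f : ∀ c, (T.compGraph c).V → V (T.color c)) : ℂ :=
  ∏ c, (X (word ρ f (ρ.top c), T.color c)).injTerm (T.compGraph c) ⟨ρ.top c, ρ.inComp_top c⟩ (f c)

theorem prodTerm_ne_zero {X : ∀ i : List (Σ q, V q) × ι, Network (J i.2) (V i.2)}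
    {ρ : T.Rooting r} {f : ∀ c, (T.compGraph c).V → V (T.color c)} (h : prodTerm X ρ f ≠ 0)
    (c : T.Comp) : (X (word ρ f (ρ.top c), T.color c)).injTerm (T.compGraph c)
      ⟨ρ.top c, ρ.inComp_top c⟩ (f c) ≠ 0 :=
  Finset.prod_ne_zero_iff.1 h c (Finset.mem_univ c)

theorem position_word {X : ∀ i : List (Σ q, V q) × ι, Network (J i.2) (V i.2)}
    {ρ : T.Rooting r} {f : ∀ c, (T.compGraph c).V → V (T.color c)} (h : prodTerm X ρ f ≠ 0)
    {c : T.Comp} {a : T.V} (ha : T.InComp c a) :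
    position X (T.color c) (word ρ f a) = f c ⟨a, ha⟩ := by
  by_cases hat : a = ρ.top c
  · subst hat
    rw [position_eq_root X (head_word_top ρ f c)]
    exact (injTerm_ne_zero.1 (prodTerm_ne_zero h c)).2.2.1.symm
  · rw [word_of_ne_top ρ f ha hat, position_cons_self]

theorem isWord_word {X : ∀ i : List (Σ q, V q) × ι, Network (J i.2) (V i.2)}
    {ρ : T.Rooting r} {f : ∀ c, (T.compGraph c).V → V (T.color c)} (h : prodTerm X ρ f ≠ 0)
    (a : T.V) : IsWord X (word ρ f a) := by
  have key : ∀ n a, ρ.depth a < n → IsWord X (word ρ f a) := by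
    intro n
    induction n with
    | zero => intro a h; omega
    | succ n ih =>
      intro a hn
      by_cases ha : a = r
      · rw [ha, word_root]
        exact isWord_nil X
      · obtain ⟨h1, h2, h3, -⟩ := injTerm_ne_zero.1 (prodTerm_ne_zero h (ρ.parent a ha))
        have h0 := ρ.depth_lt a ha
        rw [word_of_ne_root ρ f ha, isWord_cons]
        refine ⟨ih _ (lt_of_lt_of_le h0 (Nat.lt_succ_iff.1 hn)), head_word_top ρ f _, h2 _,
          fun h4 => ?_⟩
        -- The top of the component already occupies the root of the copy, so by injectivity no
        -- other vertex does.
        have h5 := congrArg Subtype.val (h1 (h4.trans h3.symm))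
        rw [← show a = ρ.top (ρ.parent a ha) from h5] at h0
        exact lt_irrefl _ h0
  exact key _ a (Nat.lt_succ_self _)

theorem injTerm_word {X : ∀ i : List (Σ q, V q) × ι, Network (J i.2) (V i.2)}
    {ρ : T.Rooting r} {f : ∀ c, (T.compGraph c).V → V (T.color c)} (h : prodTerm X ρ f ≠ 0) :
    (glue X ⊤).injTerm T r (word ρ f) = prodTerm X ρ f := by
  classical
  have hinj := word_injective ρ (fun c => (injTerm_ne_zero.1 (prodTerm_ne_zero h c)).1)
  have hroot : word ρ f r = (glue X ⊤).root := word_root ρ f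
  unfold injTerm term
  rw [if_pos hinj, if_pos ⟨fun a => mem_verts_glue_top.2 (isWord_word h a), hroot⟩, weight_glue]
  unfold prodTerm
  refine Finset.prod_congr rfl fun c _ => ?_
  obtain ⟨h1, h2, h3, -⟩ := injTerm_ne_zero.1 (prodTerm_ne_zero h c)
  unfold injTerm term
  rw [if_pos h1, if_pos ⟨h2, h3⟩]
  refine Finset.prod_congr rfl fun e _ => ?_
  have hs := ((T.compGraph c).src e).2
  have ht := ((T.compGraph c).tgt e).2
  have h4 := entry_compGraph X c e (word ρ f (ρ.top c)) (T.star e.1) (word ρ f (T.src e.1))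
    (word ρ f (T.tgt e.1))
  have h5 : position X (T.color c) (word ρ f (T.src e.1)) = _ := position_word h hs
  have h6 : position X (T.color c) (word ρ f (T.tgt e.1)) = _ := position_word h ht
  rw [h5, h6] at h4
  refine Eq.trans ?_ h4.symm
  have hb : base (T.color c) (word ρ f (T.src e.1)) = _ := base_word ρ f hs
  have hb' : base (T.color c) (word ρ f (T.tgt e.1)) = _ := base_word ρ f ht
  rw [← color_eq c e] at hb hb'
  rw [glue_top_entry, if_pos ⟨⟨isWord_word h _, isWord_word h _⟩, hb.trans hb'.symm⟩]
  exact congrArg (fun x => (X (x, (T.lab e.1).1)).entry (T.lab e.1).2 (T.star e.1) _ _) hb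

/-- The top of a component is sent to the root of its copy. By injectivity its word is not that of
the top of its parent, so it begins with a letter of the color of the parent, which is not the color
of `c`. -/
theorem base_top_eq_self {X : ∀ i : List (Σ q, V q) × ι, Network (J i.2) (V i.2)}
    {φ : T.V → List (Σ q, V q)} (h : (glue X ⊤).injTerm T r φ ≠ 0) (ρ : T.Rooting r)
    (c : T.Comp) : base (T.color c) (φ (ρ.top c)) = φ (ρ.top c) := by
  obtain ⟨hinj, -, hr, hw⟩ := injTerm_ne_zero.1 h
  have key : ∀ n c, ρ.depth (ρ.top c) < n → base (T.color c) (φ (ρ.top c)) = φ (ρ.top c) := by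
    intro n
    induction n with
    | zero => intro c h; omega
    | succ n ih =>
      intro c hn
      by_cases ha : ρ.top c = r
      · rw [ha, hr]
        rfl
      · have h0 := ρ.depth_lt _ ha
        have h1 := ih _ (lt_of_lt_of_le h0 (Nat.lt_succ_iff.1 hn))
        have h2 := base_eq_of_inComp hw (ρ.inComp_top _) (ρ.inComp_parent _ ha)
        rw [h1] at h2
        rcases eq_or_eq_of_base X (T.color (ρ.parent _ ha)) (φ (ρ.top c)) with h3 | h3
        · rw [← h2] at h3
          rw [← hinj h3] at h0
          exact absurd h0 (lt_irrefl _)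
        · rw [h3]
          exact base_eq_self (by simpa using color_parent_top_ne ρ c ha)
  exact key _ c (Nat.lt_succ_self _)

theorem exists_word_eq {X : ∀ i : List (Σ q, V q) × ι, Network (J i.2) (V i.2)}
    {φ : T.V → List (Σ q, V q)} (h : (glue X ⊤).injTerm T r φ ≠ 0) (ρ : T.Rooting r) :
    ∃ f, prodTerm X ρ f ≠ 0 ∧ word ρ f = φ := by
  classical
  obtain ⟨hinj, hv, hr, hw⟩ := injTerm_ne_zero.1 h
  have hv' : ∀ a, IsWord X (φ a) := fun a => mem_verts_glue_top.1 (hv a)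
  -- The positions are read off from `φ`; an induction on the depth shows that `word` rebuilds `φ`
  -- from them.
  let f : ∀ c, (T.compGraph c).V → V (T.color c) := fun c a => position X (T.color c) (φ a.1)
  have hbase : ∀ c (a : (T.compGraph c).V), base (T.color c) (φ a.1) = φ (ρ.top c) := fun c a =>
    (base_eq_of_inComp hw a.2 (ρ.inComp_top c)).trans (base_top_eq_self h ρ c)
  have hword : ∀ n a, ρ.depth a < n → word ρ f a = φ a := by
    intro n
    induction n with
    | zero => intro a h; omega
    | succ n ih =>
      intro a hn
      by_cases ha : a = r
      · rw [ha, word_root, hr]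
        rfl
      · have h0 := ρ.depth_lt a ha
        have h1 := hbase _ ⟨a, ρ.inComp_parent a ha⟩
        rw [word_of_ne_root ρ f ha, ih _ (lt_of_lt_of_le h0 (Nat.lt_succ_iff.1 hn))]
        rcases eq_or_eq_of_base X (T.color (ρ.parent a ha)) (φ a) with h2 | h2
        · rw [show base (T.color (ρ.parent a ha)) (φ a) = _ from h1] at h2
          rw [← hinj h2] at h0
          exact absurd h0 (lt_irrefl _)
        · rw [show base (T.color (ρ.parent a ha)) (φ a) = _ from h1] at h2
          exact h2.symm
  have hword' : word ρ f = φ := funext fun a => hword _ a (Nat.lt_succ_self _)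
  refine ⟨f, ?_, hword'⟩
  unfold prodTerm
  rw [hword']
  refine Finset.prod_ne_zero_iff.2 fun c _ => injTerm_ne_zero.2 ⟨?_, ?_, ?_, ?_⟩
  · intro a b hab
    exact Subtype.ext (hinj ((hv' a.1).ext (hv' b.1) _ ((hbase c a).trans (hbase c b).symm) hab))
  · intro a
    have := (hv' a.1).position_mem (T.color c)
    rwa [hbase c a] at this
  · exact position_eq_root X (head_ne_of_base_eq_self (base_top_eq_self h ρ c))
  · refine Finset.prod_ne_zero_iff.2 fun e _ => ?_
    have h1 := entry_compGraph X c e (φ (ρ.top c)) (T.star e.1) (φ (T.src e.1)) (φ (T.tgt e.1))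
    refine fun h0 => weight_ne_zero hw e.1 ?_
    have h2 := h1.symm.trans h0
    rw [glue_top_entry]
    have hb : base (T.color c) (φ (T.src e.1)) = _ := hbase c ((T.compGraph c).src e)
    rw [← color_eq c e] at hb
    rw [hb, h2, ite_self]

/-- The injective rooted sums of a glued network, as sums over the families of positions of the
colored components. -/
theorem injSum_glue (X : ∀ i : List (Σ q, V q) × ι, Network (J i.2) (V i.2)) (ρ : T.Rooting r) :
    (glue X ⊤).injSum T r = ∑' f, prodTerm X ρ f := by
  unfold injSum
  refine tsum_eq_tsum_of_ne_zero_bij (fun f => word ρ f.1) ?_ ?_ ?_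
  · rintro ⟨f, hf⟩ ⟨g, hg⟩ hfg
    refine Subtype.ext (funext fun c => funext fun a => ?_)
    exact (position_word hf a.2).symm.trans
      ((congrArg _ (congrFun hfg a.1)).trans (position_word hg a.2))
  · intro φ hφ
    obtain ⟨f, hf, rfl⟩ := exists_word_eq hφ ρ
    exact ⟨⟨f, hf⟩, rfl⟩
  · rintro ⟨f, hf⟩
    exact injTerm_word hf

theorem injSum_glue_eq_zero (X : ∀ i : List (Σ q, V q) × ι, Network (J i.2) (V i.2))
    (h : ¬ T.IsFreeProduct) : (glue X ⊤).injSum T r = 0 := by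
  unfold injSum
  convert tsum_zero with φ
  by_contra h0
  obtain ⟨hinj, -, -, hw⟩ := injTerm_ne_zero.1 h0
  exact h (isFreeProduct_of_weight_ne_zero hinj hw)

end Word

end Network

/-! ### Products of sums and integrals of series. -/

/-- The product of the sums of families indexed by the elements of `κ` is the sum of the products. -/
def ProdTsumEqTsumProd (𝕜 : Type*) [NormedField 𝕜] (κ : Type u) [Fintype κ] : Prop :=
  ∀ (β : κ → Type v) (a : ∀ i, β i → 𝕜), (∀ i, Summable fun x => ‖a i x‖) →
    Summable (fun f : (∀ i, β i) => ‖∏ i, a i (f i)‖) ∧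
      ∑' f : (∀ i, β i), ∏ i, a i (f i) = ∏ i, ∑' x, a i x

theorem prodTsumEqTsumProd (𝕜 : Type*) [NormedField 𝕜] [CompleteSpace 𝕜] (κ : Type u)
    [Fintype κ] : ProdTsumEqTsumProd.{u, v} 𝕜 κ := by
  classical
  refine Fintype.induction_empty_option (P := fun κ _ => ProdTsumEqTsumProd.{u, v} 𝕜 κ)
    ?_ ?_ ?_ κ
  · intro α γ _ e ih β a ha
    let : Fintype α := Fintype.ofEquiv _ e.symm
    obtain ⟨h1, h2⟩ := ih (fun i => β (e i)) (fun i => a (e i)) (fun i => ha (e i))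
    let E : (∀ i, β i) ≃ (∀ i, β (e i)) := Equiv.piCongrLeft' β e.symm
    have hE : ∀ f : ∀ i, β i, ∏ i, a (e i) (E f i) = ∏ i, a i (f i) := by
      intro f
      exact Fintype.prod_equiv e _ _ fun i => rfl
    constructor
    · refine (E.summable_iff.2 h1).congr fun f => ?_
      exact congrArg _ (hE f)
    · rw [← Fintype.prod_equiv e (fun i => ∑' x, a (e i) x) _ fun i => rfl]
      refine Eq.trans ?_ h2
      rw [← E.tsum_eq]
      exact tsum_congr fun f => (hE f).symm
  · intro β a _
    constructor
    · exact (hasSum_fintype _).summable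
    · simp
  · intro κ _ ih β a ha
    obtain ⟨h1, h2⟩ := ih _ (fun i => a (some i)) (fun i => ha (some i))
    have hE : ∀ f : ∀ i, β i, ∏ i, a i (f i) =
        a none ((Equiv.piOptionEquivProd f).1) * ∏ i, a (some i) ((Equiv.piOptionEquivProd f).2 i) :=
      fun f => Fintype.prod_option _
    constructor
    · refine ((Equiv.piOptionEquivProd (β := β)).summable_iff.2
        ((ha none).mul_norm h1)).congr
        fun f => ?_
      exact congrArg _ (hE f).symm
    · rw [Fintype.prod_option, ← h2, tsum_mul_tsum_of_summable_norm (ha none) h1]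
      refine (tsum_congr hE).trans ?_
      exact (Equiv.piOptionEquivProd (β := β)).tsum_eq (fun z : β none × (∀ i, β (some i)) =>
        a none z.1 * ∏ i, a (some i) (z.2 i))

theorem MeasureTheory.integrable_tsum {α κ E : Type*} {mα : MeasurableSpace α} {μ : Measure α}
    [NormedAddCommGroup E] [MeasurableSpace E] [BorelSpace E] [SecondCountableTopology E]
    [CompleteSpace E] [Countable κ]
    {F : κ → α → E} (hF : ∀ i, Measurable (F i)) (h : ∑' i, ∫⁻ a, ‖F i a‖ₑ ∂μ ≠ ⊤) :
    Integrable (fun a => ∑' i, F i a) μ := by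
  refine ⟨(Measurable.tsum hF).aestronglyMeasurable, ?_⟩
  refine lt_of_le_of_lt (lintegral_mono fun a => enorm_tsum_le_tsum_enorm) ?_
  rw [lintegral_tsum fun i => (hF i).enorm.aemeasurable]
  exact h.lt_top

/-! ### Factorized expectations under absolute integrability. -/

namespace Network

section Measurability

variable {J : Type u} {V : Type v} {Ω : Type*} [MeasurableSpace Ω] {M : Ω → Network J V}

theorem IsRandom.measurable_entryStar (h : IsRandom M) (j : J) (s : Bool) (a b : V) :
    Measurable fun ω => (M ω).entry j s a b := by
  unfold entry
  cases s
  · simpa using h.measurable_entry j a b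
  · exact Complex.continuous_conj.measurable.comp (h.measurable_entry j b a)

theorem IsRandom.measurable_term (h : IsRandom M) (T : TestGraph J) (r : T.V) (φ : T.V → V) :
    Measurable fun ω => (M ω).term T r φ := by
  classical
  unfold term
  refine Measurable.ite ?_ ?_ measurable_const
  · have : {ω | (∀ a, φ a ∈ (M ω).verts) ∧ φ r = (M ω).root} =
        (⋂ a, {ω | φ a ∈ (M ω).verts}) ∩ {ω | (M ω).root = φ r} := by
      ext ω
      simp [eq_comm]
    rw [this]
    exact (MeasurableSet.iInter fun a => h.measurableSet_verts _).inter (h.measurableSet_root _)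
  · unfold weight
    exact Finset.measurable_fun_prod _ fun e _ => h.measurable_entryStar _ _ _ _

theorem IsRandom.measurable_injTerm (h : IsRandom M) (T : TestGraph J) (r : T.V) (φ : T.V → V) :
    Measurable fun ω => (M ω).injTerm T r φ := by
  classical
  unfold injTerm
  split_ifs
  · exact h.measurable_term T r φ
  · exact measurable_const

end Measurability

section Expectation

variable {ι : Type w} {J : ι → Type u} {V : ι → Type v} {Ω : ι → Type*}
  [∀ q, MeasurableSpace (Ω q)] {P : ∀ q, Measure (Ω q)} [∀ q, IsProbabilityMeasure (P q)]

theorem measurePreserving_sampleMeasure {κ : Type*} [Fintype κ] (g : κ → List (Σ q, V q) × ι)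
    (hg : Function.Injective g) :
    MeasurePreserving (fun (ω : ∀ i : List (Σ q, V q) × ι, Ω i.2) c => ω (g c))
      (sampleMeasure V P) (Measure.pi fun c => P (g c).2) := by
  refine ⟨by fun_prop, ?_⟩
  rw [← Measure.infinitePi_eq_pi]
  exact Measure.map_infinitePi_infinitePi_of_inj (P := fun i : List (Σ q, V q) × ι => P i.2) hg

variable {M : ∀ q, Ω q → Network (J q) (V q)} {T : TestGraph (Σ q, J q)} {r : T.V}

theorem integral_prodTerm (ρ : T.Rooting r)
    (h : ∀ c φ, Integrable (fun ω => (M (T.color c) ω).injTerm (T.compGraph c)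
      ⟨ρ.top c, ρ.inComp_top c⟩ φ) (P (T.color c)))
    (f : ∀ c, (T.compGraph c).V → V (T.color c)) :
    Integrable (fun ω => prodTerm (fun i => M i.2 (ω i)) ρ f) (sampleMeasure V P) ∧
    ∫ ω, prodTerm (fun i => M i.2 (ω i)) ρ f ∂(sampleMeasure V P) =
      ∏ c, ∫ ω, (M (T.color c) ω).injTerm (T.compGraph c) ⟨ρ.top c, ρ.inComp_top c⟩ (f c)
        ∂(P (T.color c)) ∧
    ∫ ω, ‖prodTerm (fun i => M i.2 (ω i)) ρ f‖ ∂(sampleMeasure V P) =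
      ∏ c, ∫ ω, ‖(M (T.color c) ω).injTerm (T.compGraph c) ⟨ρ.top c, ρ.inComp_top c⟩ (f c)‖
        ∂(P (T.color c)) := by
  classical
  -- Distinctness of the copies is known only for injective positions; otherwise a factor vanishes
  -- identically and all the quantities are zero.
  by_cases hf : ∀ c, Function.Injective (f c)
  · have hg := measurePreserving_sampleMeasure (V := V) (P := P) _ (word_top_injective ρ hf)
    have h1 := Integrable.fintype_prod_dep (μ := fun c => P (T.color c)) (fun c => h c (f c))
    refine ⟨(hg.integrable_comp h1.1).2 h1, ?_, ?_⟩
    · refine Eq.trans ?_ (integral_fintype_prod_eq_prod (μ := fun c => P (T.color c)) _)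
      have h2 := h1.1
      rw [← hg.map_eq] at h2 ⊢
      exact (integral_map hg.aemeasurable h2).symm
    · refine Eq.trans ?_ (integral_fintype_prod_eq_prod (𝕜 := ℝ)
        (μ := fun c => P (T.color c)) _)
      have h2 := h1.1.norm
      simp_rw [norm_prod] at h2
      rw [← hg.map_eq] at h2 ⊢
      rw [integral_map hg.aemeasurable h2]
      simp_rw [← norm_prod]
      rfl
  · obtain ⟨c, hc⟩ := not_forall.1 hf
    have h0 : ∀ N : Network (J (T.color c)) (V (T.color c)), N.injTerm (T.compGraph c)
        ⟨ρ.top c, ρ.inComp_top c⟩ (f c) = 0 := fun N => if_neg hc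
    have h1 : ∀ ω : (∀ i : List (Σ q, V q) × ι, Ω i.2),
        prodTerm (fun i => M i.2 (ω i)) ρ f = 0 := fun ω =>
      Finset.prod_eq_zero (Finset.mem_univ c) (h0 _)
    refine ⟨by simp [h1], ?_, ?_⟩
    · rw [Finset.prod_eq_zero (Finset.mem_univ c)]
      · simp [h1]
      · simp [h0]
    · rw [Finset.prod_eq_zero (Finset.mem_univ c)]
      · simp [h1]
      · simp [h0]

/-- Absolute integrability in each component makes the series over the positions absolutely summable
in mean, which allows exchanging sum and expectation both in the glued network and in each factor.
Unimodularity plays no role here, so the result applies to truncated networks. -/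
theorem integral_injSum_glue [∀ q, Countable (V q)] (hM : ∀ q, IsRandom (M q)) (ρ : T.Rooting r)
    (h : ∀ c, ∫⁻ ω, ∑' φ, ‖(M (T.color c) ω).injTerm (T.compGraph c)
      ⟨ρ.top c, ρ.inComp_top c⟩ φ‖ₑ ∂(P (T.color c)) ≠ ⊤) :
    Integrable (fun ω => (glue (fun i => M i.2 (ω i)) ⊤).injSum T r) (sampleMeasure V P) ∧
    ∫ ω, (glue (fun i => M i.2 (ω i)) ⊤).injSum T r ∂(sampleMeasure V P) =
      ∏ c, ∫ ω, (M (T.color c) ω).injSum (T.compGraph c) ⟨ρ.top c, ρ.inComp_top c⟩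
        ∂(P (T.color c)) := by
  have hm : ∀ c φ, Measurable fun ω => (M (T.color c) ω).injTerm (T.compGraph c)
      ⟨ρ.top c, ρ.inComp_top c⟩ φ := fun c φ => (hM _).measurable_injTerm _ _ _
  have h1 : ∀ c, ∑' φ, ∫⁻ ω, ‖(M (T.color c) ω).injTerm (T.compGraph c)
      ⟨ρ.top c, ρ.inComp_top c⟩ φ‖ₑ ∂(P (T.color c)) ≠ ⊤ := fun c => by
    rw [← lintegral_tsum fun φ => (hm c φ).enorm.aemeasurable]
    exact h c
  have hint : ∀ c φ, Integrable (fun ω => (M (T.color c) ω).injTerm (T.compGraph c)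
      ⟨ρ.top c, ρ.inComp_top c⟩ φ) (P (T.color c)) := fun c φ =>
    ⟨(hm c φ).aestronglyMeasurable, (ENNReal.ne_top_of_tsum_ne_top (h1 c) φ).lt_top⟩
  have hsum : ∀ c, Summable fun φ => ∫ ω, ‖(M (T.color c) ω).injTerm (T.compGraph c)
      ⟨ρ.top c, ρ.inComp_top c⟩ φ‖ ∂(P (T.color c)) := fun c => by
    simp_rw [integral_norm_eq_lintegral_enorm (hint c _).1]
    exact ENNReal.summable_toReal (h1 c)
  have hP := fun f => integral_prodTerm (P := P) ρ hint f
  have hmP : ∀ f, Measurable fun ω : (∀ i : List (Σ q, V q) × ι, Ω i.2) =>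
      prodTerm (fun i => M i.2 (ω i)) ρ f := fun f =>
    Finset.measurable_fun_prod _ fun c _ =>
      (hm c (f c)).comp (measurable_pi_apply (word ρ f (ρ.top c), T.color c))
  have hsumP : Summable fun f => ∫ ω, ‖prodTerm (fun i => M i.2 (ω i)) ρ f‖
      ∂(sampleMeasure V P) := by
    have := (prodTsumEqTsumProd ℝ _ _ (fun c φ => ∫ ω, ‖(M (T.color c) ω).injTerm
      (T.compGraph c) ⟨ρ.top c, ρ.inComp_top c⟩ φ‖ ∂(P (T.color c))) fun c => (hsum c).norm).1
    refine this.of_norm.congr fun f => ?_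
    rw [(hP f).2.2]
  simp_rw [injSum_glue _ ρ]
  constructor
  · refine integrable_tsum hmP ?_
    have : ∀ f, ∫⁻ ω, ‖prodTerm (fun i => M i.2 (ω i)) ρ f‖ₑ ∂(sampleMeasure V P) =
        ENNReal.ofReal (∫ ω, ‖prodTerm (fun i => M i.2 (ω i)) ρ f‖ ∂(sampleMeasure V P)) :=
      fun f => (ofReal_integral_norm_eq_lintegral_enorm (hP f).1).symm
    simp_rw [this]
    exact hsumP.tsum_ofReal_ne_top
  · rw [← (hasSum_integral_of_summable_integral_norm (fun f => (hP f).1) hsumP).tsum_eq]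
    have h2 := (prodTsumEqTsumProd ℂ _ _ (fun c φ => ∫ ω, (M (T.color c) ω).injTerm
      (T.compGraph c) ⟨ρ.top c, ρ.inComp_top c⟩ φ ∂(P (T.color c))) fun c =>
        (hsum c).of_nonneg_of_le (fun _ => norm_nonneg _)
          fun φ => norm_integral_le_integral_norm _).2
    rw [tsum_congr fun f => (hP f).2.1]
    refine h2.trans (Finset.prod_congr rfl fun c _ => ?_)
    exact (hasSum_integral_of_summable_integral_norm (hint c) (hsum c)).tsum_eq

end Expectation

end Network

/-! ### Convergence of integrals under a second moment bound. -/

theorem MeasureTheory.tendsto_integral_of_lintegral_sq_le {α : Type*} {mα : MeasurableSpace α}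
    {μ : Measure α} [IsFiniteMeasure μ] {f : ℕ → α → ℂ} {g : α → ℂ}
    (hf : ∀ n, AEStronglyMeasurable (f n) μ) {B : ENNReal} (hB : B ≠ ⊤)
    (h : ∀ n, ∫⁻ a, ‖f n a‖ₑ ^ 2 ∂μ ≤ B)
    (hlim : ∀ᵐ a ∂μ, Tendsto (fun n => f n a) atTop (𝓝 (g a))) :
    Integrable g μ ∧ Tendsto (fun n => ∫ a, f n a ∂μ) atTop (𝓝 (∫ a, g a ∂μ)) := by
  have hui : UniformIntegrable f 1 μ := by
    refine uniformIntegrable_of le_rfl ENNReal.one_ne_top hf fun ε hε => ?_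
    refine ⟨(B / ENNReal.ofReal ε).toNNReal + 1, fun n => ?_⟩
    -- Where `|f| ≥ C` one has `|f| ≤ |f|² / C`, with integral at most `B / C ≤ ε`; the added `1`
    -- keeps `C` nonzero.
    set C : NNReal := (B / ENNReal.ofReal ε).toNNReal + 1 with hC
    have hε' : ENNReal.ofReal ε ≠ 0 := by simpa using hε
    have hC0 : (C : ENNReal) ≠ 0 := by
      rw [hC]
      positivity
    have hBC : B / C ≤ ENNReal.ofReal ε := by
      have hne : B / ENNReal.ofReal ε ≠ ⊤ := ENNReal.div_ne_top hB hε'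
      refine ENNReal.div_le_of_le_mul' ?_
      have : B / ENNReal.ofReal ε ≤ C := by
        rw [hC, ENNReal.coe_add, ENNReal.coe_toNNReal hne]
        exact le_self_add
      rwa [ENNReal.div_le_iff hε' ENNReal.ofReal_ne_top] at this
    refine le_trans ?_ hBC
    rw [eLpNorm_one_eq_lintegral_enorm]
    calc ∫⁻ a, ‖{x | C ≤ ‖f n x‖₊}.indicator (f n) a‖ₑ ∂μ
        ≤ ∫⁻ a, ‖f n a‖ₑ ^ 2 * (C : ENNReal)⁻¹ ∂μ := by
          refine lintegral_mono fun a => ?_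
          by_cases ha : C ≤ ‖f n a‖₊
          · rw [Set.indicator_of_mem (show a ∈ {x | C ≤ ‖f n x‖₊} from ha), ← div_eq_mul_inv,
              ENNReal.le_div_iff_mul_le (Or.inl hC0) (Or.inl ENNReal.coe_ne_top), sq]
            exact mul_le_mul_right (ENNReal.coe_le_coe.2 ha) _
          · rw [Set.indicator_of_notMem (show a ∉ {x | C ≤ ‖f n x‖₊} from ha)]
            simp
      _ = (∫⁻ a, ‖f n a‖ₑ ^ 2 ∂μ) * (C : ENNReal)⁻¹ :=
          lintegral_mul_const'' _ ((hf n).enorm.pow_const 2)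
      _ ≤ B / C := by
          rw [div_eq_mul_inv]
          exact mul_le_mul_left (h n) _
  have hg : MemLp g 1 μ := hui.memLp_of_ae_tendsto hlim
  refine ⟨memLp_one_iff_integrable.1 hg, ?_⟩
  refine tendsto_integral_of_L1' g hg.1
    (Eventually.of_forall fun n => memLp_one_iff_integrable.1 (hui.memLp n)) ?_
  exact tendsto_Lp_finite_of_tendsto_ae le_rfl ENNReal.one_ne_top hf hg hui.unifIntegrable hlim

/-! ### Truncation of the networks, and dependence on finitely many copies. -/

namespace Network

section Erase

variable {J : Type u} {V : Type v}

/-- The network with the same vertices and zero matrices. -/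
def erase (N : Network J V) : Network J V where
  verts := N.verts
  root := N.root
  root_mem := N.root_mem
  A _ _ _ := 0
  supported _ _ _ h := absurd rfl h
  locallyFinite _ _ := by simp

theorem injTerm_erase (N : Network J V) (T : TestGraph J) (r : T.V) (φ : T.V → V)
    [Nonempty T.E] : N.erase.injTerm T r φ = 0 := by
  by_contra h
  have := entry_ne_zero (weight_ne_zero (injTerm_ne_zero.1 h).2.2.2 (Classical.arbitrary T.E))
  simp [erase] at this

variable {Ω : Type*}

open Classical in
/-- The random network `M`, whose matrices are replaced by zero outside of the event `E`. -/
noncomputable def truncate (E : Set Ω) (M : Ω → Network J V) (ω : Ω) : Network J V :=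
  if ω ∈ E then M ω else (M ω).erase

/-- Truncation keeps vertices and root, so the words and the indices of the copies are unaffected;
only weights change. -/
theorem truncate_of_mem {E : Set Ω} {M : Ω → Network J V} {ω : Ω} (h : ω ∈ E) :
    truncate E M ω = M ω := if_pos h

theorem truncate_of_notMem {E : Set Ω} {M : Ω → Network J V} {ω : Ω} (h : ω ∉ E) :
    truncate E M ω = (M ω).erase := if_neg h

theorem verts_truncate (E : Set Ω) (M : Ω → Network J V) (ω : Ω) :
    (truncate E M ω).verts = (M ω).verts := by
  by_cases h : ω ∈ E
  · rw [truncate_of_mem h]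
  · rw [truncate_of_notMem h]; rfl

theorem root_truncate (E : Set Ω) (M : Ω → Network J V) (ω : Ω) :
    (truncate E M ω).root = (M ω).root := by
  by_cases h : ω ∈ E
  · rw [truncate_of_mem h]
  · rw [truncate_of_notMem h]; rfl

theorem injTerm_truncate (E : Set Ω) (M : Ω → Network J V) (ω : Ω) (T : TestGraph J) (r : T.V)
    (φ : T.V → V) [Nonempty T.E] :
    (truncate E M ω).injTerm T r φ = E.indicator (fun ω => (M ω).injTerm T r φ) ω := by
  by_cases h : ω ∈ E
  · rw [truncate_of_mem h, Set.indicator_of_mem h]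
  · rw [truncate_of_notMem h, Set.indicator_of_notMem h, injTerm_erase]

theorem injSum_truncate (E : Set Ω) (M : Ω → Network J V) (ω : Ω) (T : TestGraph J) (r : T.V)
    [Nonempty T.E] :
    (truncate E M ω).injSum T r = E.indicator (fun ω => (M ω).injSum T r) ω := by
  unfold injSum
  by_cases h : ω ∈ E <;> simp [injTerm_truncate, h]

theorem IsRandom.truncate [MeasurableSpace Ω] {M : Ω → Network J V} (hM : IsRandom M) {E : Set Ω}
    (hE : MeasurableSet E) : IsRandom (truncate E M) where
  measurableSet_verts a := by
    simp_rw [verts_truncate]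
    exact hM.measurableSet_verts a
  measurableSet_root a := by
    simp_rw [root_truncate]
    exact hM.measurableSet_root a
  measurable_entry j a b := by
    classical
    have : (fun ω => (Network.truncate E M ω).A j a b) = E.indicator fun ω => (M ω).A j a b := by
      funext ω
      by_cases h : ω ∈ E
      · rw [truncate_of_mem h, Set.indicator_of_mem h]
      · rw [truncate_of_notMem h, Set.indicator_of_notMem h]
        rfl
    rw [this]
    exact (hM.measurable_entry j a b).indicator hE

end Erase

section Locality

variable {ι : Type w} {J : ι → Type u} {V : ι → Type v}

theorem isWord_congr {X X' : ∀ i : List (Σ q, V q) × ι, Network (J i.2) (V i.2)}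
    (hv : ∀ i, (X' i).verts = (X i).verts) (hr : ∀ i, (X' i).root = (X i).root)
    (y : List (Σ q, V q)) : IsWord X' y ↔ IsWord X y := by
  induction y with
  | nil => exact iff_of_true (isWord_nil _) (isWord_nil _)
  | cons l x ih =>
    obtain ⟨q, a⟩ := l
    rw [isWord_cons, isWord_cons, ih, hv, hr]

theorem position_congr {X X' : ∀ i : List (Σ q, V q) × ι, Network (J i.2) (V i.2)}
    (hr : ∀ i, (X' i).root = (X i).root) (q : ι) (y : List (Σ q, V q)) :
    position X' q y = position X q y := by
  rcases head_ne_or_eq_cons q y with h | ⟨a, x, rfl⟩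
  · rw [position_eq_root X h, position_eq_root X' h, hr]
  · rw [position_cons_self, position_cons_self]

theorem glue_entry_congr {X X' : ∀ i : List (Σ q, V q) × ι, Network (J i.2) (V i.2)}
    (hv : ∀ i, (X' i).verts = (X i).verts) (hr : ∀ i, (X' i).root = (X i).root)
    (c : Σ q, J q) (s : Bool) (x y : List (Σ q, V q))
    (h : X' (base c.1 x, c.1) = X (base c.1 x, c.1)) :
    (glue X' ⊤).entry c s x y = (glue X ⊤).entry c s x y := by
  classical
  rw [glue_top_entry, glue_top_entry, h]
  simp only [isWord_congr hv hr, position_congr hr]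

theorem term_glue_congr {X X' : ∀ i : List (Σ q, V q) × ι, Network (J i.2) (V i.2)}
    (hv : ∀ i, (X' i).verts = (X i).verts) (hr : ∀ i, (X' i).root = (X i).root)
    (T : TestGraph (Σ q, J q)) (r : T.V) (φ : T.V → List (Σ q, V q))
    (h : ∀ e, X' (base (T.lab e).1 (φ (T.src e)), (T.lab e).1) =
      X (base (T.lab e).1 (φ (T.src e)), (T.lab e).1)) :
    (glue X' ⊤).term T r φ = (glue X ⊤).term T r φ := by
  classical
  unfold term weight
  simp only [mem_verts_glue_top, isWord_congr hv hr]
  rw [Finset.prod_congr rfl fun e _ => glue_entry_congr hv hr (T.lab e) _ _ _ (h e)]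
  rfl

/-- Every copy met by an edge of a contributing map has a nonzero entry, hence has not been erased.
-/
theorem eq_of_term_glue_ne_zero {X X' : ∀ i : List (Σ q, V q) × ι, Network (J i.2) (V i.2)}
    (h : ∀ i, X' i = X i ∨ X' i = (X i).erase)
    {T : TestGraph (Σ q, J q)} {r : T.V} {φ : T.V → List (Σ q, V q)}
    (hφ : (glue X' ⊤).term T r φ ≠ 0) (e : T.E) :
    X' (base (T.lab e).1 (φ (T.src e)), (T.lab e).1) =
      X (base (T.lab e).1 (φ (T.src e)), (T.lab e).1) := by
  classical
  refine (h _).resolve_right fun h' => ?_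
  have := weight_ne_zero (term_ne_zero.1 hφ).2.2 e
  rw [glue_top_entry, h'] at this
  have := entry_ne_zero (ite_ne_right_iff.1 this).2
  simp [erase] at this

/-- The rooted sums of a glued network depend on finitely many of the glued networks. -/
theorem exists_finite_rootedSum_glue_eq (X : ∀ i : List (Σ q, V q) × ι, Network (J i.2) (V i.2))
    (T : TestGraph (Σ q, J q)) (r : T.V) :
    ∃ D : Set (List (Σ q, V q) × ι), D.Finite ∧ ∀ X' : ∀ i : List (Σ q, V q) × ι,
      Network (J i.2) (V i.2), (∀ i, X' i = X i ∨ X' i = (X i).erase) → (∀ i ∈ D, X' i = X i) →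
      (glue X' ⊤).rootedSum T r = (glue X ⊤).rootedSum T r := by
  have hfin := (glue X ⊤).finite_support_term T r
  -- The copies visited by the finitely many maps that contribute for `X`.
  refine ⟨⋃ φ ∈ Function.support ((glue X ⊤).term T r),
    Set.range fun e : T.E => (base (T.lab e).1 (φ (T.src e)), (T.lab e).1),
    hfin.biUnion fun φ _ => Set.finite_range _, fun X' h hD => ?_⟩
  have hv : ∀ i, (X' i).verts = (X i).verts := fun i => by
    rcases h i with h | h <;> rw [h]
    rfl
  have hr : ∀ i, (X' i).root = (X i).root := fun i => by
    rcases h i with h | h <;> rw [h]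
    rfl
  rw [rootedSum_eq_tsum, rootedSum_eq_tsum]
  refine tsum_congr fun φ => ?_
  -- A map contributing for `X'` uses only unerased copies; a map contributing for `X` uses only
  -- copies in the finite set. In both cases the two terms agree.
  by_cases hφ : (glue X' ⊤).term T r φ = 0
  · by_contra hne
    rw [hφ] at hne
    have hmem : φ ∈ Function.support ((glue X ⊤).term T r) := fun h0 => hne h0.symm
    exact hne (hφ.symm.trans (term_glue_congr hv hr T r φ fun e =>
      hD _ (Set.mem_biUnion hmem ⟨e, rfl⟩)))
  · exact term_glue_congr hv hr T r φ (eq_of_term_glue_ne_zero h hφ)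

theorem eventually_rootedSum_glue_truncate {Ω : ι → Type*} (M : ∀ q, Ω q → Network (J q) (V q))
    (E : ∀ q, ℕ → Set (Ω q)) (hE : ∀ q ω, ∀ᶠ K in atTop, ω ∈ E q K)
    (T : TestGraph (Σ q, J q)) (r : T.V) (ω : ∀ i : List (Σ q, V q) × ι, Ω i.2) :
    ∀ᶠ K in atTop, (glue (fun i => truncate (E i.2 K) (M i.2) (ω i)) ⊤).rootedSum T r =
      (glue (fun i => M i.2 (ω i)) ⊤).rootedSum T r := by
  classical
  obtain ⟨D, hD, h⟩ := exists_finite_rootedSum_glue_eq (fun i => M i.2 (ω i)) T r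
  filter_upwards [(eventually_all_finite hD).2 fun i _ => hE i.2 (ω i)] with K hK
  exact h _ (fun i => ite_eq_or_eq _ _ _) fun i hi => truncate_of_mem (hK i hi)

end Locality

end Network

/-! ### Expectations of the rooted sums without absolute integrability. -/

namespace Network

section Expectation

variable {ι : Type w} {J : ι → Type u} {V : ι → Type v} {Ω : ι → Type*}

/-- The colored components of `T` with a vertex. -/
def compData (T : TestGraph (Σ q, J q)) : Set (Σ q, Σ C : TestGraph (J q), C.V) :=
  Set.range fun x : (Σ c : T.Comp, (T.compGraph c).V) => ⟨T.color x.1, T.compGraph x.1, x.2⟩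

/-- The colored components of the quotients of `T` with a vertex. -/
def quotCompData (T : TestGraph (Σ q, J q)) : Set (Σ q, Σ C : TestGraph (J q), C.V) :=
  compData T ∪ ⋃ π : Setoid T.V, compData (T.quot π)

theorem finite_compData (T : TestGraph (Σ q, J q)) : (compData T).Finite :=
  Set.finite_range _

theorem finite_quotCompData (T : TestGraph (Σ q, J q)) : (quotCompData T).Finite :=
  (finite_compData T).union (Set.finite_iUnion fun _ => finite_compData _)

/-- The event that the sums of the absolute values over the test graphs of `D` are at most `K`. -/
def boundedEvent (M : ∀ q, Ω q → Network (J q) (V q)) (D : Set (Σ q, Σ C : TestGraph (J q), C.V))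
    (q : ι) (K : ℕ) : Set (Ω q) :=
  ⋂ d ∈ {d : Σ C : TestGraph (J q), C.V | (⟨q, d⟩ : Σ q, Σ C : TestGraph (J q), C.V) ∈ D},
    {ω | ∑' φ, ‖(M q ω).injTerm d.1 d.2 φ‖ₑ ≤ K}

variable {M : ∀ q, Ω q → Network (J q) (V q)} {D : Set (Σ q, Σ C : TestGraph (J q), C.V)}

theorem finite_fiber (hD : D.Finite) (q : ι) :
    {d : Σ C : TestGraph (J q), C.V | (⟨q, d⟩ : Σ q, Σ C : TestGraph (J q), C.V) ∈ D}.Finite :=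
  hD.preimage sigma_mk_injective.injOn

/-- For each sample the absolute sums have finitely many nonzero terms, hence are finite, even when
their expectations are not. -/
theorem eventually_mem_boundedEvent (hD : D.Finite) (q : ι) (ω : Ω q) :
    ∀ᶠ K in atTop, ω ∈ boundedEvent M D q K := by
  simp only [boundedEvent, Set.mem_iInter]
  refine (eventually_all_finite (finite_fiber hD q)).2 fun d _ => ?_
  have hfin : (Function.support fun φ => ‖(M q ω).injTerm d.1 d.2 φ‖ₑ).Finite :=
    ((M q ω).finite_support_injTerm d.1 d.2).subset fun φ hφ h => hφ (by simp [h])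
  have hne : ∑' φ, ‖(M q ω).injTerm d.1 d.2 φ‖ₑ ≠ ⊤ := by
    rw [tsum_eq_finsum hfin, finsum_eq_sum _ hfin]
    exact ENNReal.sum_ne_top.2 fun φ _ => enorm_ne_top
  obtain ⟨n, hn⟩ := ENNReal.exists_nat_gt hne
  filter_upwards [eventually_ge_atTop n] with K hK
  exact hn.le.trans (by exact_mod_cast hK)

variable [∀ q, MeasurableSpace (Ω q)]

open Classical in
/-- The value of the expectation of the injective rooted sum of the glued network. -/
noncomputable def injExpectation (P : ∀ q, Measure (Ω q)) (M : ∀ q, Ω q → Network (J q) (V q))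
    (T : TestGraph (Σ q, J q)) (r : T.V) : ℂ :=
  if h : T.IsFreeProduct then ∏ c, ∫ ω, (M (T.color c) ω).injSum (T.compGraph c)
    ⟨(h.nonempty_rooting r).some.top c, (h.nonempty_rooting r).some.inComp_top c⟩ ∂(P (T.color c))
  else 0

/-- The value of the expectation of the rooted sum of the glued network. -/
noncomputable def rootedExpectation (P : ∀ q, Measure (Ω q)) (M : ∀ q, Ω q → Network (J q) (V q))
    (T : TestGraph (Σ q, J q)) (r : T.V) : ℂ :=
  injExpectation P M T r +
    ∑ π : {π : Setoid T.V // π ≠ ⊥}, injExpectation P M (T.quot π.1) (Quotient.mk π.1 r)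

theorem measurableSet_boundedEvent [∀ q, Countable (V q)] (hM : ∀ q, IsRandom (M q))
    (hD : D.Finite) (q : ι) (K : ℕ) : MeasurableSet (boundedEvent M D q K) := by
  refine MeasurableSet.biInter (finite_fiber hD q).countable fun d _ => ?_
  exact measurableSet_le (Measurable.tsum fun φ => ((hM q).measurable_injTerm _ _ _).enorm)
    measurable_const

variable {P : ∀ q, Measure (Ω q)}

instance (T : TestGraph (Σ q, J q)) (c : T.Comp) : Nonempty (T.compGraph c).E := by
  obtain ⟨e, he⟩ := T.exists_comp_eq c
  exact ⟨⟨e, he⟩⟩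

/-- The dominating function is the modulus of the whole injective sum, not the sum of the moduli.
The edge of `C` is needed for truncation to kill the sum: a single vertex would still contribute
`1`. -/
theorem tendsto_integral_injSum_truncate [∀ q, Countable (V q)] (hM : ∀ q, IsRandom (M q))
    (hI : ∀ q C v, Integrable (fun ω => (M q ω).injSum C v) (P q)) (hD : D.Finite) {q : ι}
    (C : TestGraph (J q)) (v : C.V) [Nonempty C.E] :
    Tendsto (fun K => ∫ ω, (truncate (boundedEvent M D q K) (M q) ω).injSum C v ∂(P q)) atTop
      (𝓝 (∫ ω, (M q ω).injSum C v ∂(P q))) := by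
  simp_rw [injSum_truncate]
  refine tendsto_integral_of_dominated_convergence _ (fun K => ?_) (hI q C v).norm
    (fun K => Eventually.of_forall fun ω => ?_) (Eventually.of_forall fun ω => ?_)
  · exact (hI q C v).1.indicator (measurableSet_boundedEvent hM hD _ K)
  · exact norm_indicator_le_norm_self _ _
  · refine tendsto_const_nhds.congr' ?_
    filter_upwards [eventually_mem_boundedEvent (M := M) hD _ ω] with K hK
    rw [Set.indicator_of_mem hK]

theorem tendsto_injExpectation_truncate [∀ q, Countable (V q)] (hM : ∀ q, IsRandom (M q))
    (hI : ∀ q C v, Integrable (fun ω => (M q ω).injSum C v) (P q)) (hD : D.Finite)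
    (T : TestGraph (Σ q, J q)) (r : T.V) :
    Tendsto (fun K => injExpectation P (fun q => truncate (boundedEvent M D q K) (M q)) T r) atTop
      (𝓝 (injExpectation P M T r)) := by
  unfold injExpectation
  split_ifs with h
  · exact tendsto_finsetProd _ fun c _ => tendsto_integral_injSum_truncate hM hI hD _ _
  · exact tendsto_const_nhds

theorem tendsto_rootedExpectation_truncate [∀ q, Countable (V q)] (hM : ∀ q, IsRandom (M q))
    (hI : ∀ q C v, Integrable (fun ω => (M q ω).injSum C v) (P q)) (hD : D.Finite)
    (T : TestGraph (Σ q, J q)) (r : T.V) :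
    Tendsto (fun K => rootedExpectation P (fun q => truncate (boundedEvent M D q K) (M q)) T r)
      atTop (𝓝 (rootedExpectation P M T r)) :=
  (tendsto_injExpectation_truncate hM hI hD T r).add
    (tendsto_finsetSum _ fun _ _ => tendsto_injExpectation_truncate hM hI hD _ _)

variable [∀ q, IsProbabilityMeasure (P q)]

theorem lintegral_injTerm_truncate_ne_top [∀ q, Countable (V q)] (T : TestGraph (Σ q, J q))
    (c : T.Comp) (v : (T.compGraph c).V)
    (hD : (⟨T.color c, T.compGraph c, v⟩ : Σ q, Σ C : TestGraph (J q), C.V) ∈ D) (K : ℕ) :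
    ∫⁻ ω, ∑' φ, ‖(truncate (boundedEvent M D (T.color c) K) (M (T.color c)) ω).injTerm
      (T.compGraph c) v φ‖ₑ ∂(P (T.color c)) ≠ ⊤ := by
  refine ne_top_of_le_ne_top (b := (K : ENNReal)) (ENNReal.natCast_ne_top K) ?_
  refine (lintegral_mono (g := fun _ => (K : ENNReal)) fun ω => ?_).trans (by simp)
  simp_rw [injTerm_truncate]
  by_cases h : ω ∈ boundedEvent M D (T.color c) K
  · simp_rw [Set.indicator_of_mem h]
    exact Set.mem_iInter₂.1 h (⟨T.compGraph c, v⟩ : Σ C : TestGraph (J (T.color c)), C.V) hD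
  · simp_rw [Set.indicator_of_notMem h]
    simp

theorem integral_injSum_glue_truncate [∀ q, Countable (V q)] (hM : ∀ q, IsRandom (M q))
    (hD : D.Finite) (T : TestGraph (Σ q, J q)) (hT : compData T ⊆ D) (r : T.V) (K : ℕ) :
    Integrable (fun ω => (glue (fun i => truncate (boundedEvent M D i.2 K) (M i.2) (ω i)) ⊤).injSum
      T r) (sampleMeasure V P) ∧
    ∫ ω, (glue (fun i => truncate (boundedEvent M D i.2 K) (M i.2) (ω i)) ⊤).injSum T r
      ∂(sampleMeasure V P) =
      injExpectation P (fun q => truncate (boundedEvent M D q K) (M q)) T r := by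
  unfold injExpectation
  split_ifs with h
  · exact integral_injSum_glue (M := fun q => truncate (boundedEvent M D q K) (M q))
      (fun q => (hM q).truncate (measurableSet_boundedEvent hM hD q K)) (h.nonempty_rooting r).some
      fun c => lintegral_injTerm_truncate_ne_top T c _ (hT ⟨⟨c, _⟩, rfl⟩) K
  · simp_rw [injSum_glue_eq_zero _ h]
    simp

theorem integral_rootedSum_glue_truncate [∀ q, Countable (V q)] (hM : ∀ q, IsRandom (M q))
    (hD : D.Finite) (T : TestGraph (Σ q, J q)) (hT : quotCompData T ⊆ D) (r : T.V) (K : ℕ) :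
    Integrable (fun ω => (glue (fun i => truncate (boundedEvent M D i.2 K) (M i.2)
      (ω i)) ⊤).rootedSum T r) (sampleMeasure V P) ∧
    ∫ ω, (glue (fun i => truncate (boundedEvent M D i.2 K) (M i.2) (ω i)) ⊤).rootedSum T r
      ∂(sampleMeasure V P) =
      rootedExpectation P (fun q => truncate (boundedEvent M D q K) (M q)) T r := by
  simp_rw [rootedSum_eq_injSum_add]
  obtain ⟨h1, h2⟩ := integral_injSum_glue_truncate (P := P) hM hD T
    (Set.subset_union_left.trans hT) r K
  have h3 := fun π : {π : Setoid T.V // π ≠ ⊥} => integral_injSum_glue_truncate (P := P) hM hD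
    (T.quot π.1) ((Set.subset_iUnion (fun π : Setoid T.V => compData (T.quot π)) π.1).trans
      (Set.subset_union_right.trans hT)) (Quotient.mk π.1 r) K
  have h4 := integrable_finsetSum Finset.univ fun π _ => (h3 π).1
  refine ⟨h1.add h4, ?_⟩
  rw [integral_add h1 h4, integral_finsetSum _ fun π _ => (h3 π).1, h2]
  unfold rootedExpectation
  exact congrArg _ (Finset.sum_congr rfl fun π _ => (h3 π).2)

/-- Uniform integrability replaces a dominating function: the truncated rooted sums are bounded in
`L²` and converge for every sample. -/
theorem integral_rootedSum_glue [∀ q, Countable (V q)] (hM : ∀ q, IsRandom (M q))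
    (hI : ∀ q C v, Integrable (fun ω => (M q ω).injSum C v) (P q))
    (T : TestGraph (Σ q, J q)) (r : T.V) :
    Integrable (fun ω => (glue (fun i => M i.2 (ω i)) ⊤).rootedSum T r) (sampleMeasure V P) ∧
    ∫ ω, (glue (fun i => M i.2 (ω i)) ⊤).rootedSum T r ∂(sampleMeasure V P) =
      rootedExpectation P M T r := by
  -- The same truncation must control both `T` and its double.
  let D := quotCompData T ∪ quotCompData (T.double r)
  have hD : D.Finite := (finite_quotCompData T).union (finite_quotCompData _)
  let R := fun (K : ℕ) (ω : ∀ i : List (Σ q, V q) × ι, Ω i.2) =>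
    (glue (fun i => truncate (boundedEvent M D i.2 K) (M i.2) (ω i)) ⊤).rootedSum T r
  have h1 : ∀ K, Integrable (R K) (sampleMeasure V P) ∧ ∫ ω, R K ω ∂(sampleMeasure V P) =
      rootedExpectation P (fun q => truncate (boundedEvent M D q K) (M q)) T r := fun K =>
    integral_rootedSum_glue_truncate hM hD T Set.subset_union_left r K
  have h2 := tendsto_rootedExpectation_truncate hM hI hD (T.double r) (T.doubleRoot r)
  -- The truncated expectations for the doubled graph converge, so they are bounded uniformly in
  -- `K`; these are the second moments of `R K`.
  obtain ⟨B, hB⟩ := (Metric.isBounded_range_of_tendsto _ h2).exists_norm_le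
  have h3 : ∀ K, ∫⁻ ω, ‖R K ω‖ₑ ^ 2 ∂(sampleMeasure V P) ≤ ENNReal.ofReal B := by
    intro K
    obtain ⟨h4, h5⟩ := integral_rootedSum_glue_truncate (P := P) hM hD (T.double r)
      Set.subset_union_right (T.doubleRoot r) K
    simp_rw [rootedSum_double, Complex.mul_conj] at h4 h5
    have h6 : Integrable (fun ω => Complex.normSq (R K ω)) (sampleMeasure V P) := by
      simpa using h4.re
    have h7 : ∫ ω, Complex.normSq (R K ω) ∂(sampleMeasure V P) ≤ B := by
      rw [integral_complex_ofReal] at h5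
      have := hB _ ⟨K, rfl⟩
      simp only at this
      rw [← h5, Complex.norm_real] at this
      exact (le_abs_self _).trans this
    refine le_trans (le_of_eq ?_) (ENNReal.ofReal_le_ofReal h7)
    rw [ofReal_integral_eq_lintegral_ofReal h6
      (Eventually.of_forall fun ω => Complex.normSq_nonneg _)]
    refine lintegral_congr fun ω => ?_
    rw [Complex.normSq_eq_norm_sq, ENNReal.ofReal_pow (norm_nonneg _), ofReal_norm]
  obtain ⟨h8, h9⟩ := tendsto_integral_of_lintegral_sq_le (fun K => (h1 K).1.1)
    ENNReal.ofReal_ne_top h3 (g := fun ω => (glue (fun i => M i.2 (ω i)) ⊤).rootedSum T r)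
    (Eventually.of_forall fun ω => tendsto_const_nhds.congr'
      ((eventually_rootedSum_glue_truncate M (boundedEvent M D)
        (fun q ω => eventually_mem_boundedEvent hD q ω) T r ω).mono fun K h => h.symm))
  refine ⟨h8, tendsto_nhds_unique h9 ?_⟩
  simp_rw [(h1 _).2]
  exact tendsto_rootedExpectation_truncate hM hI hD T r

end Expectation

end Network

/-! ### From expectations to unimodularity and the traffic-free product. -/

namespace TestGraph

/-- A functional is the injective version of the functional of which it gives the expansion over
the partitions. -/
theorem injectiveVersion_eq {J : Type u} {τ F : TestGraph J → ℂ}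
    (h : ∀ T : TestGraph J, τ T = F T + ∑ π : {π : Setoid T.V // π ≠ ⊥}, F (T.quot π.1)) :
    injectiveVersion τ = F := by
  have key : ∀ n, ∀ T : TestGraph J, Fintype.card T.V < n → injectiveVersion τ T = F T := by
    intro n
    induction n with
    | zero => intro T h; omega
    | succ n ih =>
      intro T hn
      rw [injectiveVersion, h T, Finset.sum_congr rfl fun π _ =>
        ih _ (lt_of_lt_of_le (T.card_quot_lt π.1 π.2) (Nat.lt_succ_iff.1 hn)), add_sub_cancel_right]
  exact funext fun T => key _ T (Nat.lt_succ_self _)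

end TestGraph

namespace Network

section Single

variable {J : Type u} {V : Type v} {Ω : Type w} [MeasurableSpace Ω] {P : Measure Ω}
  {N : Ω → Network J V}

/-- The injective version of the distribution of traffics of a unimodular random network is the
expectation of the injective rooted sums. -/
theorem IsUnimodular.integral_injSum (h : IsUnimodular P N) (T : TestGraph J) (r : T.V) :
    Integrable (fun ω => (N ω).injSum T r) P ∧
      ∫ ω, (N ω).injSum T r ∂P = TestGraph.injectiveVersion (distribution P N) T := by
  have key : ∀ n, ∀ T : TestGraph J, Fintype.card T.V < n → ∀ r : T.V,
      Integrable (fun ω => (N ω).injSum T r) P ∧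
      ∫ ω, (N ω).injSum T r ∂P = TestGraph.injectiveVersion (distribution P N) T := by
    intro n
    induction n with
    | zero => intro T h; omega
    | succ n ih =>
      intro T hn r
      have h1 : ∀ ω, (N ω).injSum T r = (N ω).rootedSum T r -
          ∑ π : {π : Setoid T.V // π ≠ ⊥}, (N ω).injSum (T.quot π.1) (Quotient.mk π.1 r) :=
        fun ω => by rw [rootedSum_eq_injSum_add, add_sub_cancel_right]
      have h2 := fun π : {π : Setoid T.V // π ≠ ⊥} => ih (T.quot π.1)
        (lt_of_lt_of_le (T.card_quot_lt π.1 π.2) (Nat.lt_succ_iff.1 hn)) (Quotient.mk π.1 r)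
      have h3 := integrable_finsetSum Finset.univ fun π _ => (h2 π).1
      simp_rw [h1]
      refine ⟨(h.integrable T r).sub h3, ?_⟩
      rw [integral_sub (h.integrable T r) h3, integral_finsetSum _ fun π _ => (h2 π).1,
        TestGraph.injectiveVersion, Finset.sum_congr rfl fun π _ => (h2 π).2]
      -- `distribution` uses a chosen vertex of `T`; unimodularity moves it to `r`.
      exact congrArg (· - _) (h.rootedState_eq T _ _)
  exact key _ T (Nat.lt_succ_self _) r

theorem rootedState_rootComponent (T : TestGraph J) (r : T.V) :
    rootedState P (fun ω => (N ω).rootComponent) T r = rootedState P N T r := by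
  unfold rootedState
  simp_rw [rootedSum_rootComponent]

theorem distribution_rootComponent :
    distribution P (fun ω => (N ω).rootComponent) = distribution P N :=
  funext fun _ => rootedState_rootComponent _ _

theorem IsUnimodular.rootComponent (h : IsUnimodular P N)
    (hr : IsRandom fun ω => (N ω).rootComponent) :
    IsUnimodular P fun ω => (N ω).rootComponent where
  isRandom := hr
  integrable T r := by
    simp_rw [rootedSum_rootComponent]
    exact h.integrable T r
  rootedState_eq T r r' := by
    rw [rootedState_rootComponent, rootedState_rootComponent]
    exact h.rootedState_eq T r r'

end Single

section Free

variable {ι : Type w} {J : ι → Type u} {V : ι → Type v} {Ω : ι → Type*}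
  [∀ q, MeasurableSpace (Ω q)] {P : ∀ q, Measure (Ω q)}
  {M : ∀ q, Ω q → Network (J q) (V q)}

open Classical in
theorem injExpectation_eq (hM : ∀ q, IsUnimodular (P q) (M q)) (T : TestGraph (Σ q, J q))
    (r : T.V) : injExpectation P M T r = if T.IsFreeProduct then ∏ c : T.Comp,
      TestGraph.injectiveVersion (distribution (P (T.color c)) (M (T.color c))) (T.compGraph c)
      else 0 := by
  unfold injExpectation
  split_ifs
  · exact Finset.prod_congr rfl fun c _ => ((hM _).integral_injSum _ _).2
  · rfl

open Classical in
-- The right-hand side does not mention `r`: unimodularity of the factors removes the dependence on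
-- the tops of the components.
theorem rootedExpectation_eq (hM : ∀ q, IsUnimodular (P q) (M q)) (T : TestGraph (Σ q, J q))
    (r : T.V) : rootedExpectation P M T r =
      (if T.IsFreeProduct then ∏ c : T.Comp, TestGraph.injectiveVersion
        (distribution (P (T.color c)) (M (T.color c))) (T.compGraph c) else 0) +
      ∑ π : {π : Setoid T.V // π ≠ ⊥}, if (T.quot π.1).IsFreeProduct then
        ∏ c : (T.quot π.1).Comp, TestGraph.injectiveVersion
          (distribution (P ((T.quot π.1).color c)) (M ((T.quot π.1).color c)))
          ((T.quot π.1).compGraph c) else 0 := by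
  unfold rootedExpectation
  rw [injExpectation_eq hM]
  exact congrArg _ (Finset.sum_congr rfl fun π _ => injExpectation_eq hM _ _)

variable [∀ q, IsProbabilityMeasure (P q)]

theorem isUnimodular_glue [∀ q, Countable (V q)] (hM : ∀ q, IsUnimodular (P q) (M q))
    (hr : IsRandom fun ω : (∀ i : List (Σ q, V q) × ι, Ω i.2) => glue (fun i => M i.2 (ω i)) ⊤) :
    IsUnimodular (sampleMeasure V P) (fun ω => glue (fun i => M i.2 (ω i)) ⊤) := by
  have h := fun (T : TestGraph (Σ q, J q)) (r : T.V) => integral_rootedSum_glue (P := P)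
    (fun q => (hM q).isRandom) (fun q C v => ((hM q).integral_injSum C v).1) T r
  refine ⟨hr, fun T r => (h T r).1, fun T r r' => ?_⟩
  unfold rootedState
  rw [(h T r).2, (h T r').2]
  rw [rootedExpectation_eq hM, rootedExpectation_eq hM]

theorem isTrafficFreeProduct_glue [∀ q, Countable (V q)] (hM : ∀ q, IsUnimodular (P q) (M q)) :
    TestGraph.IsTrafficFreeProduct (distribution (sampleMeasure V P)
      (fun ω => glue (fun i => M i.2 (ω i)) ⊤)) (fun q => distribution (P q) (M q)) := by
  classical
  intro T
  rw [TestGraph.injectiveVersion_eq (F := fun T => if T.IsFreeProduct then ∏ c : T.Comp,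
      TestGraph.injectiveVersion (distribution (P (T.color c)) (M (T.color c))) (T.compGraph c)
      else 0) fun T => ?_]
  refine (integral_rootedSum_glue (P := P) (fun q => (hM q).isRandom)
    (fun q C v => ((hM q).integral_injSum C v).1) T _).2.trans ?_
  rw [rootedExpectation_eq hM]

end Free

end Network

/-! ### Measurability for the local topology. -/

namespace Network

section Measurability

variable {J : Type u} {V : Type v} {Ω : Type w} [MeasurableSpace Ω] {N : Ω → Network J V}

theorem mem_ball_iff {N : Network J V} {p : ℕ} {a : V} :
    a ∈ N.ball p ↔ ∃ n < p, ∃ q : N.graph.Walk N.root a, q.length = n := by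
  constructor
  · intro h
    have h' : N.graph.edist N.root a < p := h
    obtain ⟨q, hq⟩ := SimpleGraph.exists_walk_of_edist_ne_top (ne_top_of_lt h')
    refine ⟨q.length, ?_, q, rfl⟩
    rw [← hq] at h'
    exact_mod_cast h'
  · rintro ⟨n, hn, q, rfl⟩
    exact lt_of_le_of_lt (SimpleGraph.Walk.edist_le q) (by exact_mod_cast hn)

theorem IsRandom.measurableSet_adj [Countable J] (h : IsRandom N) (a b : V) :
    MeasurableSet {ω | (N ω).graph.Adj a b} := by
  have h1 : ∀ a b, MeasurableSet {ω | ∃ j, (N ω).A j a b ≠ 0} := fun a b => by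
    have : {ω | ∃ j, (N ω).A j a b ≠ 0} = ⋃ j, {ω | (N ω).A j a b ≠ 0} := by
      ext ω
      simp
    rw [this]
    exact MeasurableSet.iUnion fun j => (h.measurable_entry j a b (measurableSet_singleton 0)).compl
  have h2 : {ω | (N ω).graph.Adj a b} =
      {_ω | a ≠ b} ∩ ({ω | ∃ j, (N ω).A j a b ≠ 0} ∪ {ω | ∃ j, (N ω).A j b a ≠ 0}) := by
    ext ω
    simp [graph, SimpleGraph.fromRel_adj]
  rw [h2]
  exact (MeasurableSet.const _).inter ((h1 a b).union (h1 b a))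

theorem IsRandom.measurableSet_walk [Countable J] [Countable V] (h : IsRandom N) (n : ℕ) (a b : V) :
    MeasurableSet {ω | ∃ q : (N ω).graph.Walk a b, q.length = n} := by
  induction n generalizing a with
  | zero =>
    have : {ω | ∃ q : (N ω).graph.Walk a b, q.length = 0} = {_ω | a = b} := by
      ext ω
      constructor
      · rintro ⟨q, hq⟩
        exact SimpleGraph.Walk.eq_of_length_eq_zero hq
      · rintro rfl
        exact ⟨SimpleGraph.Walk.nil, rfl⟩
    rw [this]
    exact MeasurableSet.const _
  | succ n ih =>
    have : {ω | ∃ q : (N ω).graph.Walk a b, q.length = n + 1} =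
        ⋃ c, {ω | (N ω).graph.Adj a c} ∩ {ω | ∃ q : (N ω).graph.Walk c b, q.length = n} := by
      ext ω
      rw [Set.mem_iUnion]
      constructor
      · rintro ⟨q, hq⟩
        cases q with
        | nil => simp at hq
        | @cons _ c _ hadj q => exact ⟨c, hadj, q, by simpa using hq⟩
      · rintro ⟨c, hadj, q, hq⟩
        exact ⟨SimpleGraph.Walk.cons hadj q, by simp [hq]⟩
    rw [this]
    exact MeasurableSet.iUnion fun c => (h.measurableSet_adj a c).inter (ih c)

theorem IsRandom.measurableSet_walk_root [Countable J] [Countable V] (h : IsRandom N) (n : ℕ)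
    (b : V) : MeasurableSet {ω | ∃ q : (N ω).graph.Walk (N ω).root b, q.length = n} := by
  have : {ω | ∃ q : (N ω).graph.Walk (N ω).root b, q.length = n} =
      ⋃ a, {ω | (N ω).root = a} ∩ {ω | ∃ q : (N ω).graph.Walk a b, q.length = n} := by
    ext ω
    rw [Set.mem_iUnion]
    constructor
    · exact fun h => ⟨_, rfl, h⟩
    · rintro ⟨a, rfl, h⟩
      exact h
  rw [this]
  exact MeasurableSet.iUnion fun a => (h.measurableSet_root a).inter (h.measurableSet_walk n a b)

theorem IsRandom.measurableSet_ball [Countable J] [Countable V] (h : IsRandom N) (p : ℕ) (b : V) :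
    MeasurableSet {ω | b ∈ (N ω).ball p} := by
  have : {ω | b ∈ (N ω).ball p} =
      ⋃ n, ⋃ (_ : n < p), {ω | ∃ q : (N ω).graph.Walk (N ω).root b, q.length = n} := by
    ext ω
    simp only [Set.mem_iUnion]
    exact mem_ball_iff.trans ⟨fun ⟨n, h1, h2⟩ => ⟨n, h1, h2⟩, fun ⟨n, h1, h2⟩ => ⟨n, h1, h2⟩⟩
  rw [this]
  exact MeasurableSet.iUnion fun n => MeasurableSet.iUnion fun _ => h.measurableSet_walk_root n b

theorem IsRandom.measurableSet_reachable [Countable J] [Countable V] (h : IsRandom N) (b : V) :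
    MeasurableSet {ω | (N ω).graph.Reachable (N ω).root b} := by
  have : {ω | (N ω).graph.Reachable (N ω).root b} =
      ⋃ n, {ω | ∃ q : (N ω).graph.Walk (N ω).root b, q.length = n} := by
    ext ω
    rw [Set.mem_iUnion]
    exact ⟨fun ⟨q⟩ => ⟨_, q, rfl⟩, fun ⟨_, q, _⟩ => ⟨q⟩⟩
  rw [this]
  exact MeasurableSet.iUnion fun n => h.measurableSet_walk_root n b

theorem IsRandom.rootComponent [Countable J] [Countable V] (h : IsRandom N) :
    IsRandom fun ω => (N ω).rootComponent where
  measurableSet_verts a := (h.measurableSet_verts a).inter (h.measurableSet_reachable a)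
  measurableSet_root a := h.measurableSet_root a
  measurable_entry j a b := by
    classical
    exact Measurable.ite ((h.measurableSet_reachable a).inter (h.measurableSet_reachable b))
      (h.measurable_entry j a b) measurable_const

/-- Basic open sets commute with unions in `o`, so a countable basis of the space of matrices
suffices. The topology is thus second countable, and its Borel sets are generated by this countable
subbasis. -/
theorem localTopology_eq (J : Type u) (V : Type v) [Countable J] :
    localTopology J V = TopologicalSpace.generateFrom (⋃ (p : ℕ) (n : ℕ) (i : Fin n),
      basicOpen J V p n i '' TopologicalSpace.countableBasis (J → Fin n → Fin n → ℂ)) := by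
  refine le_antisymm (TopologicalSpace.generateFrom_anti ?_) (le_generateFrom ?_)
  · intro U hU
    simp only [Set.mem_iUnion] at hU
    obtain ⟨p, n, i, o, ho, rfl⟩ := hU
    exact ⟨p, n, i, o, TopologicalSpace.isOpen_of_mem_countableBasis ho, rfl⟩
  · rintro _ ⟨p, n, i, o, ho, rfl⟩
    have : basicOpen J V p n i o = ⋃₀ (basicOpen J V p n i ''
        {o' | o' ∈ TopologicalSpace.countableBasis (J → Fin n → Fin n → ℂ) ∧ o' ⊆ o}) := by
      ext N
      constructor
      · rintro ⟨φ, h1, h2⟩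
        obtain ⟨o', ho', h3, h4⟩ := (TopologicalSpace.isBasis_countableBasis
          (J → Fin n → Fin n → ℂ)).exists_subset_of_mem_open h2 ho
        exact ⟨_, ⟨o', ⟨ho', h4⟩, rfl⟩, φ, h1, h3⟩
      · rintro ⟨_, ⟨o', ⟨-, h4⟩, rfl⟩, φ, h1, h3⟩
        exact ⟨φ, h1, h4 h3⟩
    rw [this]
    refine @isOpen_sUnion _ (TopologicalSpace.generateFrom _) _ ?_
    rintro _ ⟨o', ⟨ho', -⟩, rfl⟩
    refine TopologicalSpace.isOpen_generateFrom_of_mem ?_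
    simp only [Set.mem_iUnion]
    exact ⟨p, n, i, o', ho', rfl⟩

theorem IsRandom.measurableSet_basicOpen [Countable J] [Countable V] (h : IsRandom N) {p n : ℕ}
    (i : Fin n) {o : Set (J → Fin n → Fin n → ℂ)} (ho : IsOpen o) :
    MeasurableSet (N ⁻¹' basicOpen J V p n i o) := by
  -- The enumeration of the ball depends on the sample; it is replaced by a union over the countably
  -- many deterministic injections into `V`.
  have : N ⁻¹' basicOpen J V p n i o = ⋃ (f : Fin n → V) (_ : Function.Injective f),
      (⋂ a, {ω | a ∈ (N ω).ball p ↔ a ∈ Set.range f}) ∩ {ω | (N ω).root = f i} ∩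
        (fun ω j k l => (N ω).A j (f k) (f l)) ⁻¹' o := by
    ext ω
    simp only [Set.mem_iUnion]
    constructor
    · rintro ⟨φ, h1, h2⟩
      refine ⟨fun k => φ k, Subtype.val_injective.comp φ.injective,
        ⟨Set.mem_iInter.2 fun a => ⟨fun ha => ?_, ?_⟩, h1.symm⟩, h2⟩
      · exact ⟨φ.symm ⟨a, ha⟩, by simp⟩
      · rintro ⟨k, rfl⟩
        exact (φ k).2
    · rintro ⟨f, hf, ⟨h1, h2⟩, h3⟩
      have h4 : Set.range f = (N ω).ball p :=
        Set.ext fun a => (Set.mem_iInter.1 h1 a).symm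
      exact ⟨(Equiv.ofInjective f hf).trans (Equiv.setCongr h4), Eq.symm h2, h3⟩
  rw [this]
  refine MeasurableSet.iUnion fun f => MeasurableSet.iUnion fun _ =>
    ((MeasurableSet.iInter fun a => ?_).inter (h.measurableSet_root _)).inter ?_
  · exact (h.measurableSet_ball p a).iff (MeasurableSet.const _)
  · refine (measurable_pi_lambda _ fun j => measurable_pi_lambda _ fun k =>
      measurable_pi_lambda _ fun l => h.measurable_entry j (f k) (f l)) ho.measurableSet

theorem IsRandom.measurable [Countable J] [Countable V] (h : IsRandom N) : Measurable N := by
  have hc : (⋃ (p : ℕ) (n : ℕ) (i : Fin n), basicOpen J V p n i ''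
      TopologicalSpace.countableBasis (J → Fin n → Fin n → ℂ)).Countable :=
    Set.countable_iUnion fun p => Set.countable_iUnion fun n => Set.countable_iUnion fun i =>
      (TopologicalSpace.countable_countableBasis _).image _
  have : SecondCountableTopology (Network J V) := ⟨_, hc, localTopology_eq J V⟩
  refine Measurable.mono (measurable_generateFrom ?_) le_rfl
    (borel_eq_generateFrom_of_subbasis (localTopology_eq J V)).le
  intro U hU
  simp only [Set.mem_iUnion] at hU
  obtain ⟨p, n, i, o, ho, rfl⟩ := hU
  exact h.measurableSet_basicOpen i (TopologicalSpace.isOpen_of_mem_countableBasis ho)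

end Measurability

section Glue

variable {ι : Type w} {J : ι → Type u} {V : ι → Type v} {Ω : ι → Type*}
  [∀ q, MeasurableSpace (Ω q)] {M : ∀ q, Ω q → Network (J q) (V q)}

theorem measurableSet_isWord (hM : ∀ q, IsRandom (M q)) (y : List (Σ q, V q)) :
    MeasurableSet {ω : ∀ i : List (Σ q, V q) × ι, Ω i.2 | IsWord (fun i => M i.2 (ω i)) y} := by
  induction y with
  | nil => simp [isWord_nil]
  | cons l x ih =>
    obtain ⟨q, a⟩ := l
    simp only [isWord_cons]
    have hX : Measurable fun ω : (∀ i : List (Σ q, V q) × ι, Ω i.2) => ω (x, q) :=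
      measurable_pi_apply _
    refine ih.inter ((MeasurableSet.const _).inter ((hX ((hM q).measurableSet_verts a)).inter ?_))
    refine MeasurableSet.compl (s := {ω : ∀ i : List (Σ q, V q) × ι, Ω i.2 |
      a = (M q (ω (x, q))).root}) ?_
    simp_rw [eq_comm (a := a)]
    exact hX ((hM q).measurableSet_root a)

theorem measurableSet_position_eq (hM : ∀ q, IsRandom (M q)) (q : ι) (y : List (Σ q, V q))
    (a : V q) : MeasurableSet {ω : ∀ i : List (Σ q, V q) × ι, Ω i.2 |
      position (fun i => M i.2 (ω i)) q y = a} := by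
  rcases head_ne_or_eq_cons q y with h | ⟨b, x, rfl⟩
  · simp_rw [position_eq_root _ h]
    exact measurable_pi_apply (X := fun i : List (Σ q, V q) × ι => Ω i.2) (y, q)
      ((hM q).measurableSet_root a)
  · simp_rw [position_cons_self]
    exact MeasurableSet.const _

theorem isRandom_glue [∀ q, Countable (V q)] (hM : ∀ q, IsRandom (M q)) (n : ℕ∞) :
    IsRandom fun ω : (∀ i : List (Σ q, V q) × ι, Ω i.2) => glue (fun i => M i.2 (ω i)) n := by
  have hv : ∀ y, MeasurableSet {ω : ∀ i : List (Σ q, V q) × ι, Ω i.2 |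
      y ∈ (glue (fun i => M i.2 (ω i)) n).verts} := fun y => by
    simp_rw [mem_verts_glue]
    exact (measurableSet_isWord hM y).inter (MeasurableSet.const _)
  refine ⟨hv, fun a => MeasurableSet.const ([] = a), fun c x y => ?_⟩
  classical
  simp_rw [glue_A]
  refine Measurable.ite (((hv x).inter (hv y)).inter (MeasurableSet.const _)) ?_ measurable_const
  intro s hs
  -- The positions can be random, through the roots of the copies; one decomposes over their
  -- countably many values.
  have : (fun ω : (∀ i : List (Σ q, V q) × ι, Ω i.2) => (M c.1 (ω (base c.1 x, c.1))).A c.2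
      (position (fun i => M i.2 (ω i)) c.1 x) (position (fun i => M i.2 (ω i)) c.1 y)) ⁻¹' s =
      ⋃ (a : V c.1) (b : V c.1), {ω | position (fun i => M i.2 (ω i)) c.1 x = a} ∩
        {ω | position (fun i => M i.2 (ω i)) c.1 y = b} ∩
        (fun ω => (M c.1 (ω (base c.1 x, c.1))).A c.2 a b) ⁻¹' s := by
    ext ω
    simp only [Set.mem_iUnion]
    constructor
    · exact fun h => ⟨_, _, ⟨rfl, rfl⟩, h⟩
    · rintro ⟨a, b, ⟨rfl, rfl⟩, h⟩
      exact h
  refine this ▸ ?_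
  exact MeasurableSet.iUnion fun a => MeasurableSet.iUnion fun b =>
    ((measurableSet_position_eq hM c.1 x a).inter (measurableSet_position_eq hM c.1 y b)).inter
      ((((hM c.1).measurable_entry c.2 a b).comp (measurable_pi_apply
        (X := fun i : List (Σ q, V q) × ι => Ω i.2) (base c.1 x, c.1))) hs)

end Glue

end Network

/-! ### Stabilization of balls and local convergence. -/

namespace Network

section Convergence

variable {ι : Type w} {J : ι → Type u} {V : ι → Type v}
  {X : ∀ i : List (Σ q, V q) × ι, Network (J i.2) (V i.2)}

theorem glue_A_eq_top {m : ℕ} {c : Σ q, J q} {x y : List (Σ q, V q)} (hx : x.length < m)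
    (hy : y.length ≤ m) : (glue X m).A c x y = (glue X ⊤).A c x y := by
  classical
  -- A copy is present after `m` steps when it is attached to a word of length less than `m`, whence
  -- the strict inequality for `x`.
  have hb : (base c.1 x).length < m := by
    rcases length_base c.1 x with h | h
    · rwa [h]
    · omega
  rw [glue_A, glue_A]
  simp only [mem_verts_glue, le_top, ENat.natCast_lt_top, and_true]
  simp only [Nat.cast_le, Nat.cast_lt, hb, hx.le, hy, and_true]

theorem A_eq_zero_of_glue_top {m : ℕ} {c : Σ q, J q} {x y : List (Σ q, V q)}
    (h : (glue X ⊤).A c x y = 0) : (glue X m).A c x y = 0 := by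
  classical
  rw [glue_A] at h ⊢
  simp only [mem_verts_glue, le_top, ENat.natCast_lt_top, and_true] at h ⊢
  rw [ite_eq_right_iff] at h ⊢
  exact fun h' => h ⟨⟨h'.1.1.1, h'.1.2.1⟩, h'.2.1⟩

theorem graph_glue_le (m : ℕ) : (glue X m).graph ≤ (glue X ⊤).graph := by
  intro x y h
  obtain ⟨hne, h⟩ := (SimpleGraph.fromRel_adj _ _ _).1 h
  exact (SimpleGraph.fromRel_adj _ _ _).2 ⟨hne, h.imp
    (fun ⟨c, hc⟩ => ⟨c, fun h0 => hc (A_eq_zero_of_glue_top h0)⟩)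
    (fun ⟨c, hc⟩ => ⟨c, fun h0 => hc (A_eq_zero_of_glue_top h0)⟩)⟩

/-- Adjacent vertices have the same base for some color, and removing at most one letter yields the
base. A walk of length `n` from the root thus stays among words of length at most `n`. -/
theorem length_le_of_adj {x y : List (Σ q, V q)} (h : (glue X ⊤).graph.Adj x y) :
    y.length ≤ x.length + 1 := by
  classical
  have key : ∃ q : ι, base q x = base q y := by
    obtain ⟨-, ⟨c, hc⟩ | ⟨c, hc⟩⟩ := (SimpleGraph.fromRel_adj _ _ _).1 h
    · exact ⟨c.1, (ite_ne_right_iff.1 hc).1.2.1⟩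
    · exact ⟨c.1, (ite_ne_right_iff.1 hc).1.2.1.symm⟩
  obtain ⟨q, hq⟩ := key
  have h1 := length_base q x
  have h2 := length_base q y
  rw [hq] at h1
  rcases h1 with h1 | h1 <;> rcases h2 with h2 | h2
  · rw [← h1, h2]
    exact Nat.le_succ _
  · rw [← h1]
    omega
  · rw [h2] at h1
    omega
  · omega

theorem exists_walk_glue {m : ℕ} {x y : List (Σ q, V q)} (q : (glue X ⊤).graph.Walk x y)
    (h : x.length + q.length < m) : y.length ≤ x.length + q.length ∧
      ∃ q' : (glue X m).graph.Walk x y, q'.length = q.length := by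
  induction q with
  | nil => exact ⟨le_rfl, SimpleGraph.Walk.nil, rfl⟩
  | @cons x z y hadj q ih =>
    rw [SimpleGraph.Walk.length_cons] at h ⊢
    have hz := length_le_of_adj hadj
    obtain ⟨h1, q', hq'⟩ := ih (by omega)
    have hadj' : (glue X m).graph.Adj x z := by
      obtain ⟨hne, hA⟩ := (SimpleGraph.fromRel_adj _ _ _).1 hadj
      refine (SimpleGraph.fromRel_adj _ _ _).2 ⟨hne, ?_⟩
      refine hA.imp (fun ⟨c, hc⟩ => ⟨c, ?_⟩) (fun ⟨c, hc⟩ => ⟨c, ?_⟩)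
      · rwa [glue_A_eq_top (by omega) (by omega)]
      · rwa [glue_A_eq_top (by omega) (by omega)]
    exact ⟨by omega, SimpleGraph.Walk.cons hadj' q', congrArg (· + 1) hq'⟩

theorem ball_glue_eq {p m : ℕ} (hpm : p ≤ m) : (glue X m).ball p = (glue X ⊤).ball p := by
  ext y
  rw [mem_ball_iff, mem_ball_iff]
  constructor
  · rintro ⟨n, hn, q, hq⟩
    exact ⟨n, hn, q.mapLe (graph_glue_le m), (SimpleGraph.Walk.length_map _ _).trans hq⟩
  · rintro ⟨n, hn, q, rfl⟩
    obtain ⟨-, q', hq'⟩ := exists_walk_glue (m := m) q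
      (show ([] : List (Σ q, V q)).length + q.length < m by rw [List.length_nil]; omega)
    exact ⟨_, hn, q', hq'⟩

theorem length_lt_of_mem_ball {p : ℕ} {y : List (Σ q, V q)} (h : y ∈ (glue X ⊤).ball p) :
    y.length < p := by
  obtain ⟨n, hn, q, rfl⟩ := mem_ball_iff.1 h
  have := (exists_walk_glue q (Nat.lt_succ_self _)).1
  exact lt_of_le_of_lt (this.trans (by simp [glue])) hn

theorem tendsto_glue (X : ∀ i : List (Σ q, V q) × ι, Network (J i.2) (V i.2)) :
    Tendsto (fun m : ℕ => glue X m) atTop (𝓝 (glue X ⊤)) := by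
  refine TopologicalSpace.tendsto_nhds_generateFrom_iff.2 ?_
  rintro _ ⟨p, n, i, o, -, rfl⟩ ⟨φ, h1, h2⟩
  filter_upwards [eventually_ge_atTop p] with m hm
  refine ⟨φ.trans (Equiv.setCongr (ball_glue_eq hm).symm), h1, ?_⟩
  -- The same enumeration works, because all entries between vertices of the ball are already final
  -- at step `m`.
  convert h2 using 4 with j k l
  exact glue_A_eq_top (lt_of_lt_of_le (length_lt_of_mem_ball (φ k).2) hm)
    (le_of_lt (lt_of_lt_of_le (length_lt_of_mem_ball (φ l).2) hm))

end Convergence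

end Network

/-! ### Convergence in law and conclusion. -/

theorem MeasureTheory.tendstoInDistribution_of_forall_tendsto {Ω E : Type*} [MeasurableSpace Ω]
    {μ : Measure Ω} [IsProbabilityMeasure μ] [TopologicalSpace E] [MeasurableSpace E]
    [BorelSpace E] {Y : ℕ → Ω → E} {Z : Ω → E} (hY : ∀ n, Measurable (Y n)) (hZ : Measurable Z)
    (h : ∀ ω, Tendsto (fun n => Y n ω) atTop (𝓝 (Z ω))) :
    TendstoInDistribution Y atTop Z (fun _ => μ) μ := by
  refine ⟨fun n => (hY n).aemeasurable, hZ.aemeasurable, ?_⟩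
  refine ProbabilityMeasure.tendsto_iff_forall_integral_tendsto.2 fun f => ?_
  have hf : ∀ (Z : Ω → E), Measurable Z → ∫ x, f x ∂(μ.map Z) = ∫ ω, f (Z ω) ∂μ := fun Z hZ =>
    integral_map hZ.aemeasurable f.continuous.measurable.aestronglyMeasurable
  simp only [ProbabilityMeasure.coe_mk, hf _ (hY _), hf _ hZ]
  exact tendsto_integral_filter_of_norm_le_const
    (Eventually.of_forall fun n => (f.continuous.measurable.comp (hY n)).aestronglyMeasurable)
    ⟨‖f‖, Eventually.of_forall fun n => Eventually.of_forall fun ω => f.norm_coe_le_norm _⟩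
    (Eventually.of_forall fun ω => (f.continuous.tendsto _).comp (h ω))

theorem mainTheorem11 {p : ℕ} {J : Fin p → Type u} {V : Fin p → Type v} {Ω : Fin p → Type w}
    [∀ q, Countable (J q)] [∀ q, Countable (V q)] [∀ q, MeasurableSpace (Ω q)]
    (P : ∀ q, Measure (Ω q)) [∀ q, IsProbabilityMeasure (P q)]
    (N : ∀ q, Ω q → Network (J q) (V q)) (hN : ∀ q, Network.IsUnimodular (P q) (N q)) :
    TendstoInDistribution (fun n : ℕ => Network.localFreeProduct N n) atTop
        (Network.localFreeProduct N ⊤) (fun _ => Network.sampleMeasure V P)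
        (Network.sampleMeasure V P) ∧
      Network.IsUnimodular (Network.sampleMeasure V P) (Network.localFreeProduct N ⊤) ∧
      TestGraph.IsTrafficFreeProduct
        (Network.distribution (Network.sampleMeasure V P) (Network.localFreeProduct N ⊤))
        (fun q => Network.distribution (P q) (N q)) := by
  -- The construction glues root components, which inherit measurability and unimodularity and have
  -- the same distributions of traffics.
  have hr : ∀ q, Network.IsRandom fun ω => (N q ω).rootComponent := fun q =>
    (hN q).isRandom.rootComponent
  have hM : ∀ q, Network.IsUnimodular (P q) fun ω => (N q ω).rootComponent := fun q =>
    (hN q).rootComponent (hr q)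
  have hg := fun n : ℕ∞ => Network.isRandom_glue hr n
  refine ⟨tendstoInDistribution_of_forall_tendsto (fun n => (hg n).measurable) (hg ⊤).measurable
    fun ω => Network.tendsto_glue _, Network.isUnimodular_glue hM (hg ⊤), ?_⟩
  have h := Network.isTrafficFreeProduct_glue hM
  simp_rw [Network.distribution_rootComponent] at h
  exact h
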